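/- **Setting.** For every $\varepsilon\ge 0$ let $Z^{(\varepsilon)}_n$, $n=0,1,\dots$, be a discrete-time regenerative process on a measurable space $(\mathcal X,\Gamma)$ with proper regeneration times $0=\tau^{(\varepsilon)}_0<\tau^{(\varepsilon)}_1<\cdots$, and let $\mu^{(\varepsilon)}$ be a random variable on the same probability space with values in $\{0,1,\dots,\infty\}$. Put $$P^{(\varepsilon)}(n,A)=\mathsf P\{Z^{(\varepsilon)}_n\in A,\ \mu^{(\varepsilon)}>n\},\qquad q^{(\varepsilon)}(n,A)=\mathsf P\{Z^{(\varepsilon)}_n\in A,\ \mu^{(\varepsilon)}\wedge\tau^{(\varepsilon)}_1>n\},$$ $$f^{(\varepsilon)}(n)=\mathsf P\{\tau_1^{(\varepsilon)}=n,\ \mu^{(\varepsilon)}>\tau^{(\varepsilon)}_1\},\qquad f^{(\varepsilon)}=1-\sum_{n\ge0}f^{(\varepsilon)}(n),$$ and assume that $\mu^{(\varepsilon)}$ is a regenerative stopping time, that is, for all $A\in\Gamma$ and $n\ge 0$, $$P^{(\varepsilon)}(n,A)=q^{(\varepsilon)}(n,A)+\sum_{j=0}^nP^{(\varepsilon)}(n-j,A)f^{(\varepsilon)}(j).$$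 For $\rho\in\mathbb R$ and $r=0,1,\dots$ let $\phi^{(\varepsilon)}(\rho,r)=\sum_{n\ge0}n^re^{\rho n}f^{(\varepsilon)}(n)\in[0,\infty]$ and $\phi^{(\varepsilon)}(\rho)=\phi^{(\varepsilon)}(\rho,0)$. Let $k\ge 0$ be an integer. **Conditions.** * $\mathbf{A^*}$: (a) $f^{(\varepsilon)}(n)\to f^{(0)}(n)$ as $\varepsilon\to0$ for every $n\ge0$, where $f^{(0)}(\cdot)$ is non-periodic ($\gcd\{n: f^{(0)}(n)>0\}=1$) and not concentrated at zero; (b) $f^{(\varepsilon)}\to f^{(0)}\in[0,1)$ as $\varepsilon\to0$. * $\mathbf{B^*}$: there is $\delta>0$ with (a) $\limsup_{0\le\varepsilon\to0}\phi^{(\varepsilon)}(\delta)<\infty$ and (b) $\phi^{(0)}(\delta)>1$. Under $\mathbf{A^*}$ and $\mathbf{B^*}$, for all sufficiently small $\varepsilon\ge0$ the characteristic equation $\phi^{(\varepsilon)}(\rho)=1$ has a unique non-negative root, denoted $\rho^{(\varepsilon)}$ (this is part of the assertion). * $\mathbf{C^*}$: there are real numbers $a_{n,r}$ such that, for $r=0,\dots,k$,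 $a_{0,r}=\phi^{(0)}(\rho^{(0)},r)$ and $\phi^{(\varepsilon)}(\rho^{(0)},r)=a_{0,r}+a_{1,r}\varepsilon+\cdots+a_{k-r,r}\varepsilon^{k-r}+o(\varepsilon^{k-r})$ as $\varepsilon\to0$. * $\mathbf{D^*}$: there is $\gamma>0$ with $\limsup_{0\le\varepsilon\to0}\sum_{n\ge0}e^{(\rho^{(0)}+\gamma)n}q^{(\varepsilon)}(n,\mathcal X)<\infty$. Let $\Gamma_0=\{A\in\Gamma:\ q^{(\varepsilon)}(n,A)\to q^{(0)}(n,A)\text{ as }\varepsilon\to0,\ n=0,1,\dots\}$ and $$\widetilde\pi^{(0)}(A)=\frac{\sum_{n\ge0}e^{\rho^{(0)}n}q^{(0)}(n,A)}{\sum_{n\ge0}ne^{\rho^{(0)}n}f^{(0)}(n)}.$$ **Theorem.** Assume $\mathbf{A^*}$, $\mathbf{B^*}$ and $\mathbf{C^*}$. (i) As $\varepsilon\to0$, $\rho^{(\varepsilon)}=\rho^{(0)}+c_1\varepsilon+\cdots+c_k\varepsilon^k+o(\varepsilon^k)$, where $c_1=-a_{1,0}/a_{0,1}$ and, for $n=2,\dots,k$,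 $$c_n=-\frac1{a_{0,1}}\Bigg(a_{n,0}+\sum_{q=1}^{n-1}a_{n-q,1}c_q+\sum_{m=2}^n\sum_{q=m}^na_{n-q,m}\sum_{(n_1,\dots,n_{q-1})\in D_{m,q}}\ \prod_{p=1}^{q-1}\frac{c_p^{n_p}}{n_p!}\Bigg),$$ $D_{m,q}$ being the set of all non-negative integer solutions of $n_1+\cdots+n_{q-1}=m$, $n_1+2n_2+\cdots+(q-1)n_{q-1}=q$. (ii) If in addition $\mathbf{D^*}$ holds, then for every non-negative integer valued function $n^{(\varepsilon)}\to\infty$ (as $\varepsilon\to0$) such that $\varepsilon^rn^{(\varepsilon)}\to\lambda_r\in[0,\infty)$ for some $1\le r\le k$, $$\frac{P^{(\varepsilon)}(n^{(\varepsilon)},A)}{\exp\big(-(\rho^{(0)}+c_1\varepsilon+\cdots+c_{r-1}\varepsilon^{r-1})n^{(\varepsilon)}\big)}\to\frac{\widetilde\pi^{(0)}(A)}{e^{\lambda_rc_r}}\quad\text{as }\varepsilon\to0,\qquad A\in\Gamma_0 .$$ -/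

import Mathlib

universe u v

open Filter Topology MeasureTheory ProbabilityTheory Asymptotics
open scoped NNReal ENNReal

/-- A discrete time regenerative process `Z` on the measurable space `𝒳`, with proper regeneration
times `0 = τ 0 < τ 1 < ⋯`, together with a random variable `μ` on the same probability space with
values in `{0, 1, …, ∞}`.

The regenerative property is the weakest usual one: for every `k`, the process after the `k`-th
regeneration time, together with its own regeneration times, is independent of `τ 0, …, τ k` and
has the same law as the original process with its regeneration times. -/
structure StoppedRegenerativeProcess (𝒳 : Type u) [MeasurableSpace 𝒳] where
  Ω : Type v
  [mΩ : MeasurableSpace Ω]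
  P : Measure Ω
  [isProb : IsProbabilityMeasure P]
  Z : ℕ → Ω → 𝒳
  τ : ℕ → Ω → ℕ
  μ : Ω → ℕ∞
  measurable_Z : ∀ n, Measurable (Z n)
  measurable_τ : ∀ k, Measurable (τ k)
  measurable_μ : Measurable μ
  τ_zero : ∀ᵐ ω ∂P, τ 0 ω = 0
  τ_strictMono : ∀ᵐ ω ∂P, StrictMono fun k => τ k ω
  indep : ∀ k, IndepFun
    (fun ω => ((fun n => Z (τ k ω + n) ω, fun j => τ (k + j) ω - τ k ω) : (ℕ → 𝒳) × (ℕ → ℕ)))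
    (fun ω (i : Fin (k + 1)) => τ i ω) P
  identDistrib : ∀ k, IdentDistrib
    (fun ω => ((fun n => Z (τ k ω + n) ω, fun j => τ (k + j) ω - τ k ω) : (ℕ → 𝒳) × (ℕ → ℕ)))
    (fun ω => ((fun n => Z n ω, fun j => τ j ω) : (ℕ → 𝒳) × (ℕ → ℕ))) P P

attribute [instance] StoppedRegenerativeProcess.mΩ StoppedRegenerativeProcess.isProb

noncomputable section

namespace StoppedRegenerativeProcess

variable {𝒳 : Type u} [MeasurableSpace 𝒳] (S : StoppedRegenerativeProcess.{u, v} 𝒳)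

/-- `P(n, A) = P{Z_n ∈ A, μ > n}`. -/
def prob (n : ℕ) (A : Set 𝒳) : ℝ := S.P.real {ω | S.Z n ω ∈ A ∧ (n : ℕ∞) < S.μ ω}

/-- `q(n, A) = P{Z_n ∈ A, μ ∧ τ₁ > n}`. -/
def q (n : ℕ) (A : Set 𝒳) : ℝ :=
  S.P.real {ω | S.Z n ω ∈ A ∧ (n : ℕ∞) < min (S.μ ω) (S.τ 1 ω : ℕ∞)}

/-- `f(k) = P{τ₁ = k, μ > τ₁}`. -/
def f (k : ℕ) : ℝ := S.P.real {ω | S.τ 1 ω = k ∧ (S.τ 1 ω : ℕ∞) < S.μ ω}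

/-- `μ` is a regenerative stopping time: `P(n, A)` satisfies the renewal equation. -/
def IsRegenerativeStoppingTime : Prop :=
  ∀ A : Set 𝒳, MeasurableSet A → ∀ n : ℕ,
    S.prob n A = S.q n A + ∑ k ∈ Finset.range (n + 1), S.prob (n - k) A * S.f k

/-- The defect `1 - ∑ f(n)` of the distribution `f`. -/
def defect : ℝ := 1 - ∑' n, S.f n

/-- `φ(ρ, r) = ∑ n^r e^{ρ n} f(n)`, a sum of nonnegative terms with values in `[0, ∞]`;
`φ(ρ, 0) = φ(ρ)` is the moment generating function. -/
def phi (ρ : ℝ) (r : ℕ) : ℝ≥0∞ :=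
  ∑' n : ℕ, ENNReal.ofReal ((n : ℝ) ^ r * Real.exp (ρ * n) * S.f n)

/-- `∑ e^{ρ n} q(n, A)`, a sum of nonnegative terms with values in `[0, ∞]`. -/
def qSum (ρ : ℝ) (A : Set 𝒳) : ℝ≥0∞ :=
  ∑' n : ℕ, ENNReal.ofReal (Real.exp (ρ * n) * S.q n A)

/-- `ρ` is a non-negative solution of the characteristic equation `φ(ρ) = 1`. -/
def IsCharRoot (ρ : ℝ) : Prop := 0 ≤ ρ ∧ S.phi ρ 0 = 1

/-- The non-negative root of the characteristic equation, when there is exactly one. -/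
def charRoot : ℝ := sInf {ρ : ℝ | S.IsCharRoot ρ}

/-- `π̃(A) = (∑ e^{ρ n} q(n, A)) / (∑ n e^{ρ n} f(n))`, where `ρ` is the root of the
characteristic equation. -/
def piTilde (A : Set 𝒳) : ℝ :=
  (S.qSum S.charRoot A).toReal / (S.phi S.charRoot 1).toReal

end StoppedRegenerativeProcess

namespace PerturbedRegenerative

variable {𝒳 : Type u} [MeasurableSpace 𝒳] (S : ℝ≥0 → StoppedRegenerativeProcess.{u, v} 𝒳)

/-- A sequence of weights on `ℕ` is non-periodic: the greatest common divisor of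
`{n : g n > 0}` is `1`. -/
def NonPeriodic (g : ℕ → ℝ) : Prop := ∀ d : ℕ, (∀ n, 0 < g n → d ∣ n) → d = 1

/-- Condition `A*`. -/
structure CondA : Prop where
  tendsto_f : ∀ n, Tendsto (fun ε => (S ε).f n) (𝓝[>] 0) (𝓝 ((S 0).f n))
  nonPeriodic : NonPeriodic (S 0).f
  not_concentrated_zero : ∃ n, n ≠ 0 ∧ 0 < (S 0).f n
  tendsto_defect : Tendsto (fun ε => (S ε).defect) (𝓝[>] 0) (𝓝 (S 0).defect)
  defect_mem : (S 0).defect ∈ Set.Ico (0 : ℝ) 1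

/-- Condition `B*`. -/
def CondB : Prop :=
  ∃ δ : ℝ, 0 < δ ∧ limsup (fun ε => (S ε).phi δ 0) (𝓝 0) < ∞ ∧ 1 < (S 0).phi δ 0

/-- Condition `C*` of order `k` with coefficients `a n r`, where `a 0 r = φ⁽⁰⁾(ρ⁽⁰⁾, r)`. -/
structure CondC (k : ℕ) (a : ℕ → ℕ → ℝ) : Prop where
  a_zero : ∀ r ≤ k, a 0 r = ((S 0).phi (S 0).charRoot r).toReal
  expansion : ∀ r ≤ k,
    (fun ε : ℝ≥0 => ((S ε).phi (S 0).charRoot r).toReal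
        - ∑ n ∈ Finset.range (k - r + 1), a n r * (ε : ℝ) ^ n)
      =o[𝓝[>] 0] fun ε : ℝ≥0 => (ε : ℝ) ^ (k - r)

/-- Condition `D*`. -/
def CondD : Prop :=
  ∃ γ : ℝ, 0 < γ ∧ limsup (fun ε => (S ε).qSum ((S 0).charRoot + γ) Set.univ) (𝓝 0) < ∞

/-- The class `Γ₀` of measurable sets. -/
def Gamma0 : Set (Set 𝒳) :=
  {A | MeasurableSet A ∧
    ∀ n, Tendsto (fun ε => (S ε).q n A) (𝓝[>] 0) (𝓝 ((S 0).q n A))}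

/-- The finite set `D_{m,q}` of all non-negative integer solutions `(n_1, …, n_{q-1})` of
`n_1 + ⋯ + n_{q-1} = m`, `n_1 + 2 n_2 + ⋯ + (q-1) n_{q-1} = q`. A tuple `(n_1, …, n_{q-1})` is
represented by the function `ℕ → ℕ` that extends it by zero. -/
def D (m q : ℕ) : Finset (ℕ → ℕ) :=
  ((Finset.Icc 1 (q - 1)).piAntidiag m).filter
    fun v => ∑ p ∈ Finset.Icc 1 (q - 1), p * v p = q

theorem mem_D {m q : ℕ} {v : ℕ → ℕ} :
    v ∈ D m q ↔ (∀ p, p ∉ Finset.Icc 1 (q - 1) → v p = 0) ∧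
      ∑ p ∈ Finset.Icc 1 (q - 1), v p = m ∧ ∑ p ∈ Finset.Icc 1 (q - 1), p * v p = q := by
  simp only [D, Finset.mem_filter, Finset.mem_piAntidiag]
  constructor
  · rintro ⟨⟨h1, h2⟩, h3⟩
    exact ⟨fun p hp => by_contra fun h => hp (h2 p h), h1, h3⟩
  · rintro ⟨h1, h2, h3⟩
    exact ⟨⟨h2, fun p hp => by_contra fun h => hp (h1 p h)⟩, h3⟩

/-- The recursion that determines the coefficients `c 1, …, c k` from the coefficients `a n r`. -/
structure CoeffRecursion (k : ℕ) (a : ℕ → ℕ → ℝ) (c : ℕ → ℝ) : Prop where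
  one : 1 ≤ k → c 1 = -a 1 0 / a 0 1
  step : ∀ n, 2 ≤ n → n ≤ k →
    c n = -(1 / a 0 1) *
      (a n 0 + ∑ q ∈ Finset.Icc 1 (n - 1), a (n - q) 1 * c q
        + ∑ m ∈ Finset.Icc 2 n, ∑ q ∈ Finset.Icc m n, a (n - q) m *
            ∑ v ∈ D m q, ∏ p ∈ Finset.Icc 1 (q - 1), c p ^ v p / (Nat.factorial (v p) : ℝ))

end PerturbedRegenerative

end

/-! The process enters only through the sequences `f`, `q`, `prob` and the renewal equation that
links them. Condition B* dominates `f` by a constant times e^{-δn}, uniformly in small ε. Hence all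
mixed moments converge for arguments below δ, and strict monotonicity together with the intermediate
value theorem gives a unique root that depends continuously on ε at 0 (`exists_charRoot`).

Part (i) is an inversion of φ(ρ) = 1. Taylor's formula at ρ⁽⁰⁾ turns it into a polynomial equation
in Δ = ρ⁽ᵋ⁾ − ρ⁽⁰⁾ with a uniform remainder O(Δ^{k+1}). Since the limiting derivative `a 0 1` is
positive, Δ = O(ε). The recursion for `c` says exactly that p(ε) = c₁ε + ⋯ + c_kε^k solves the
truncated equation up to O(ε^{k+1}). Subtracting the equations for Δ and p leaves (Δ − p)·H = o(ε^k)
with H → `a 0 1`, so Δ − p = o(ε^k) (`isLittleO_root_expansion`).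

For part (ii), multiplying the renewal equation by e^{ρ⁽ᵋ⁾n} makes the step distribution proper. A
renewal theorem uniform in ε (`tendsto_perturbed_renewal`) then yields e^{ρ⁽ᵋ⁾n}P(n, A) → π̃(A). Its
proof takes limits of the shifted solutions, which are bounded harmonic functions on ℤ and hence
constant by Choquet-Deny; a summed form of the renewal equation identifies the constant. Finally the
expansion of ρ⁽ᵋ⁾ replaces the exponent, at the cost of the factor e^{-λc_r}. -/

namespace PerturbedRegenerative

/-! ### Bounded harmonic functions on the integers -/

/-- A bounded function on `ℤ` that is harmonic for the step distribution `p` cannot increase along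
a step of positive probability. -/
theorem harmonic_le_sub {p : ℕ → ℝ} (hp : ∀ n, 0 ≤ p n) (hp1 : HasSum p 1) {w : ℤ → ℝ} {C : ℝ}
    (hw : ∀ n, |w n| ≤ C) (hh : ∀ n : ℤ, w n = ∑' j : ℕ, p j * w (n - j)) {d : ℕ} (hd : 0 < p d)
    (n : ℤ) : w n ≤ w (n - d) := by
  have hsum : ∀ n : ℤ, Summable fun j : ℕ => p j * w (n - j) := fun n =>
    Summable.of_norm_bounded (hp1.summable.mul_right C) fun j => by
      rw [norm_mul, Real.norm_of_nonneg (hp j)]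
      exact mul_le_mul_of_nonneg_left (hw _) (hp j)
  set h : ℤ → ℝ := fun n => w n - w (n - d) with hdef
  have hbdd : BddAbove (Set.range h) := ⟨2 * C, by
    rintro _ ⟨n, rfl⟩
    have h1 := abs_le.1 (hw n)
    have h2 := abs_le.1 (hw (n - d))
    simp only [hdef]; linarith⟩
  set s := ⨆ n, h n with hs
  have hle : ∀ n, h n ≤ s := fun n => le_ciSup hbdd n
  -- The function s − h is non-negative and harmonic, so a single term of its averaging sum is at
  -- most its value: near-maximality of h at n passes to n − d.
  have hstep : ∀ n : ℤ, p d * (s - h (n - d)) ≤ s - h n := by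
    intro n
    have h1 : HasSum (fun j : ℕ => p j * (s - h (n - j))) (s - h n) := by
      have e1 := (hsum n).hasSum
      have e2 := (hsum (n - d)).hasSum
      rw [← hh] at e1 e2
      have e3 := (hp1.mul_right s).sub (e1.sub e2)
      rw [one_mul] at e3
      refine e3.congr_fun ?_
      intro j
      simp only [hdef]
      rw [show n - (j : ℤ) - d = n - d - j by ring]
      ring
    have := h1.summable.le_tsum d fun j _ => mul_nonneg (hp j) (sub_nonneg.2 (hle _))
    rwa [h1.tsum_eq] at this
  have hiter : ∀ (i : ℕ) (n : ℤ), p d ^ i * (s - h (n - i * d)) ≤ s - h n := by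
    intro i
    induction i with
    | zero => intro n; simp
    | succ i ih =>
      intro n
      have h1 := mul_le_mul_of_nonneg_left (ih (n - d)) (hp d)
      have h2 := hstep n
      rw [show n - ((i + 1 : ℕ) : ℤ) * d = n - d - i * d by push_cast; ring, pow_succ]
      nlinarith
  have hd1 : p d ≤ 1 := by
    have := hp1.summable.le_tsum d fun j _ => hp j
    rwa [hp1.tsum_eq] at this
  -- If s > 0, a near-maximum of h propagates along K steps of length d. Telescoping then makes w n
  -- − w (n − K d) at least K s − 1, which exceeds 2C by the choice of K. The tolerance p_d^K/(K+1)
  -- allows for the loss of a factor p_d at each step.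
  have hs0 : s ≤ 0 := by
    by_contra! hpos
    obtain ⟨K, hK⟩ := exists_nat_gt ((2 * C + 1) / s)
    rw [div_lt_iff₀ hpos] at hK
    have hKpos : (0 : ℝ) < K + 1 := by positivity
    have hη : 0 < p d ^ K / (K + 1) := by positivity
    obtain ⟨n, hn⟩ := exists_lt_of_lt_ciSup (show s - p d ^ K / (K + 1) < ⨆ n, h n by linarith)
    have hlow : ∀ i ∈ Finset.range K, s - 1 / (K + 1) ≤ h (n - i * d) := by
      intro i hi
      have h1 := hiter i n
      have h2 : p d ^ K ≤ p d ^ i :=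
        pow_le_pow_of_le_one (hp d) hd1 (Finset.mem_range.1 hi).le
      have h3 : 0 ≤ s - h (n - i * d) := sub_nonneg.2 (hle _)
      have h4 : p d ^ K * (s - h (n - i * d)) ≤ p d ^ K * (1 / (K + 1)) := by
        calc _ ≤ p d ^ i * (s - h (n - i * d)) := mul_le_mul_of_nonneg_right h2 h3
          _ ≤ s - h n := h1
          _ ≤ p d ^ K / (K + 1) := by linarith
          _ = _ := by ring
      have := le_of_mul_le_mul_left h4 (pow_pos hd K)
      linarith
    have h1 := Finset.sum_le_sum hlow
    have h2 : ∑ i ∈ Finset.range K, h (n - i * d) = w n - w (n - K * d) := by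
      have := Finset.sum_range_sub' (fun i : ℕ => w (n - i * d)) K
      simp only [Nat.cast_zero, zero_mul, sub_zero] at this
      rw [← this]
      refine Finset.sum_congr rfl fun i _ => ?_
      simp only [hdef]
      rw [show n - ((i + 1 : ℕ) : ℤ) * d = n - i * d - d by push_cast; ring]
    rw [h2, Finset.sum_const, Finset.card_range, nsmul_eq_mul] at h1
    have h3 := abs_le.1 (hw n)
    have h4 := abs_le.1 (hw (n - K * d))
    have h5 : (K : ℝ) * (1 / (K + 1)) ≤ 1 := by
      rw [mul_one_div, div_le_one hKpos]; linarith
    nlinarith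
  have := hle n
  simp only [hdef] at this
  linarith

/-- The Choquet-Deny theorem on `ℤ`: bounded harmonic functions of a non-periodic step
distribution are constant. -/
theorem harmonic_const {p : ℕ → ℝ} (hp : ∀ n, 0 ≤ p n) (hp1 : HasSum p 1) (hper : NonPeriodic p)
    {w : ℤ → ℝ} {C : ℝ} (hw : ∀ n, |w n| ≤ C)
    (hh : ∀ n : ℤ, w n = ∑' j : ℕ, p j * w (n - j)) (n : ℤ) : w n = w 0 := by
  have hd : ∀ d : ℕ, 0 < p d → ∀ n : ℤ, w n = w (n - d) := by
    intro d hd n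
    refine le_antisymm (harmonic_le_sub hp hp1 hw hh hd n) ?_
    have := harmonic_le_sub hp hp1 (w := fun n => -w n) (C := C) (fun n => by rw [abs_neg]; exact hw n)
      (fun n => by simp only [mul_neg, tsum_neg]; rw [hh n]) hd n
    linarith
  -- The periods of w form a subgroup of ℤ containing the support of p; its generator divides the
  -- whole support, hence is ±1.
  let H : AddSubgroup ℤ :=
    { carrier := {m | ∀ n, w (n + m) = w n}
      zero_mem' := fun n => by rw [add_zero]
      add_mem' := fun {x y} hx hy n => by rw [← add_assoc, hy, hx]
      neg_mem' := fun {x} hx n => by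
        have := hx (n + -x)
        rw [neg_add_cancel_right] at this
        exact this.symm }
  obtain ⟨g, hg⟩ := Int.subgroup_cyclic H
  have hg1 : g.natAbs = 1 := by
    refine hper _ fun m hm => ?_
    have hmH : (m : ℤ) ∈ H := fun n => by
      have := hd m hm (n + m)
      rwa [add_sub_cancel_right] at this
    rw [hg, AddSubgroup.mem_closure_singleton] at hmH
    obtain ⟨z, hz⟩ := hmH
    rw [← Int.natCast_dvd_natCast, Int.natAbs_dvd]
    exact ⟨z, by rw [← hz, smul_eq_mul, mul_comm]⟩
  have hnH : n ∈ H := by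
    rw [hg, AddSubgroup.mem_closure_singleton]
    rcases Int.natAbs_eq g with h | h <;> rw [hg1] at h
    · exact ⟨n, by rw [h]; simp⟩
    · exact ⟨-n, by rw [h]; simp⟩
  have := hnH 0
  rwa [zero_add] at this

/-! ### Renewal equations and the perturbed renewal theorem -/

/-- `renewalTail p n = ∑_{j > n} p j` for a probability distribution `p`. -/
noncomputable def renewalTail (p : ℕ → ℝ) (n : ℕ) : ℝ := 1 - ∑ j ∈ Finset.range (n + 1), p j

theorem renewalTail_eq_tsum {p : ℕ → ℝ} (hp1 : HasSum p 1) (n : ℕ) :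
    renewalTail p n = ∑' j, p (j + (n + 1)) := by
  rw [renewalTail, ← hp1.tsum_eq, ← hp1.summable.sum_add_tsum_nat_add (n + 1)]
  ring

theorem renewalTail_nonneg {p : ℕ → ℝ} (hp : ∀ n, 0 ≤ p n) (hp1 : HasSum p 1) (n : ℕ) :
    0 ≤ renewalTail p n := by
  rw [renewalTail_eq_tsum hp1]
  exact tsum_nonneg fun _ => hp _

theorem renewalTail_le {p : ℕ → ℝ} (hp1 : HasSum p 1) {M r : ℝ}
    (hr0 : 0 ≤ r) (hr1 : r < 1) (hM : ∀ n, p n ≤ M * r ^ n) (n : ℕ) :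
    renewalTail p n ≤ M * r / (1 - r) * r ^ n := by
  rw [renewalTail_eq_tsum hp1]
  have h1 : HasSum (fun j : ℕ => M * r ^ (n + 1) * r ^ j) (M * r ^ (n + 1) * (1 - r)⁻¹) :=
    (hasSum_geometric_of_lt_one hr0 hr1).mul_left _
  calc ∑' j, p (j + (n + 1)) ≤ ∑' j : ℕ, M * r ^ (n + 1) * r ^ j := by
        refine Summable.tsum_le_tsum (fun j => ?_) ((summable_nat_add_iff (n + 1)).2 hp1.summable)
          h1.summable
        refine (hM _).trans_eq ?_
        rw [pow_add]; ring
    _ = _ := by rw [h1.tsum_eq, pow_succ]; ring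

theorem renewalTail_succ (p : ℕ → ℝ) (n : ℕ) :
    renewalTail p (n + 1) = renewalTail p n - p (n + 1) := by
  rw [renewalTail, Finset.sum_range_succ, renewalTail]; ring

/-- The sum of the tails of a probability distribution is its mean. -/
theorem tsum_renewalTail {p : ℕ → ℝ} (hp : ∀ n, 0 ≤ p n) (hp1 : HasSum p 1) {M r : ℝ}
    (hr0 : 0 ≤ r) (hr1 : r < 1) (hM : ∀ n, p n ≤ M * r ^ n) :
    ∑' n, renewalTail p n = ∑' n : ℕ, n * p n := by
  -- Summation by parts; the boundary term n · `renewalTail p n` vanishes in the limit by geometric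
  -- decay.
  have hpart : ∀ n : ℕ, ∑ j ∈ Finset.range n, renewalTail p j
      = n * renewalTail p n + ∑ i ∈ Finset.range (n + 1), i * p i := by
    intro n
    induction n with
    | zero => simp
    | succ n ih =>
      rw [Finset.sum_range_succ, ih, Finset.sum_range_succ _ (n + 1), renewalTail_succ]
      push_cast; ring
  have hpow : Summable fun n : ℕ => (n : ℝ) * r ^ n := by
    simpa using summable_pow_mul_geometric_of_norm_lt_one 1
      (show ‖r‖ < 1 by rwa [Real.norm_of_nonneg hr0])
  have hs1 : Summable (renewalTail p) :=
    Summable.of_nonneg_of_le (renewalTail_nonneg hp hp1) (renewalTail_le hp1 hr0 hr1 hM)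
      ((summable_geometric_of_lt_one hr0 hr1).mul_left _)
  have hs2 : Summable fun n : ℕ => (n : ℝ) * p n :=
    Summable.of_nonneg_of_le (fun n => mul_nonneg n.cast_nonneg (hp n))
      (fun n => mul_le_mul_of_nonneg_left (hM n) n.cast_nonneg)
      ((hpow.mul_left M).congr fun n => by ring)
  have ht : Tendsto (fun n : ℕ => (n : ℝ) * renewalTail p n) atTop (𝓝 0) := by
    refine squeeze_zero (fun n => mul_nonneg n.cast_nonneg (renewalTail_nonneg hp hp1 n))
      (fun n => mul_le_mul_of_nonneg_left (renewalTail_le hp1 hr0 hr1 hM n) n.cast_nonneg) ?_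
    have := hpow.tendsto_atTop_zero.const_mul (M * r / (1 - r))
    rw [mul_zero] at this
    exact this.congr fun n => by ring
  have h1 := hs1.hasSum.tendsto_sum_nat
  have h2 := ht.add (hs2.hasSum.tendsto_sum_nat.comp (tendsto_add_atTop_nat 1))
  rw [zero_add] at h2
  exact tendsto_nhds_unique h1 (h2.congr fun n => (hpart n).symm)

/-- Summation of the renewal equation. -/
theorem sum_renewalTail_mul {p g x : ℕ → ℝ}
    (hx : ∀ n, x n = g n + ∑ j ∈ Finset.range (n + 1), x (n - j) * p j) (n : ℕ) :
    ∑ j ∈ Finset.range (n + 1), renewalTail p j * x (n - j)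
      = ∑ j ∈ Finset.range (n + 1), g j := by
  induction n with
  | zero =>
    have := hx 0
    simp only [zero_add, Finset.sum_range_one, Nat.sub_zero] at this ⊢
    simp only [renewalTail, zero_add, Finset.sum_range_one]
    linarith
  | succ n ih =>
    have h := hx (n + 1)
    rw [Finset.sum_range_succ'] at h ⊢
    rw [Finset.sum_range_succ g, ← ih]
    simp only [Nat.add_sub_add_right, Nat.sub_zero, renewalTail_succ, sub_mul,
      Finset.sum_sub_distrib] at h ⊢
    have h0 : renewalTail p 0 = 1 - p 0 := by simp [renewalTail]
    rw [h0]
    simp only [mul_comm (p _)]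
    linarith

/-- Since p 0 = 0, the tail at 0 equals 1, so x n is one term of the non-negative convolution that
`sum_renewalTail_mul` evaluates as a partial sum of g. -/
theorem renewal_le {p g x : ℕ → ℝ} (hp : ∀ n, 0 ≤ p n) (hp0 : p 0 = 0) (hp1 : HasSum p 1)
    {G : ℕ → ℝ} (hG : Summable G) (hg : ∀ n, 0 ≤ g n ∧ g n ≤ G n) (hx0 : ∀ n, 0 ≤ x n)
    (hx : ∀ n, x n = g n + ∑ j ∈ Finset.range (n + 1), x (n - j) * p j) (n : ℕ) :
    x n ≤ ∑' n, G n := by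
  have h0 : renewalTail p 0 = 1 := by simp [renewalTail, hp0]
  calc x n = renewalTail p 0 * x (n - 0) := by rw [h0, one_mul, Nat.sub_zero]
    _ ≤ ∑ j ∈ Finset.range (n + 1), renewalTail p j * x (n - j) :=
        Finset.single_le_sum (f := fun j => renewalTail p j * x (n - j))
          (fun j _ => mul_nonneg (renewalTail_nonneg hp hp1 j) (hx0 _)) (by simp)
    _ = ∑ j ∈ Finset.range (n + 1), g j := sum_renewalTail_mul hx n
    _ ≤ ∑ j ∈ Finset.range (n + 1), G j := Finset.sum_le_sum fun j _ => (hg j).2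
    _ ≤ _ := hG.sum_le_tsum _ fun j _ => (hg j).1.trans (hg j).2

/-- Extension of a sequence by zero to the negative integers. -/
def extendZero (x : ℕ → ℝ) (n : ℤ) : ℝ := if 0 ≤ n then x n.toNat else 0

theorem tsum_mul_extendZero (p x : ℕ → ℝ) (n : ℕ) :
    ∑' j : ℕ, p j * extendZero x ((n : ℤ) - j) = ∑ j ∈ Finset.range (n + 1), p j * x (n - j) := by
  rw [tsum_eq_sum (s := Finset.range (n + 1))]
  · refine Finset.sum_congr rfl fun j hj => ?_
    have hj := Finset.mem_range.1 hj
    rw [extendZero, if_pos (by omega), show ((n : ℤ) - j).toNat = n - j by omega]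
  · intro j hj
    have hj : ¬ j < n + 1 := fun h => hj (Finset.mem_range.2 h)
    rw [extendZero, if_neg (by omega), mul_zero]

/-- The renewal theorem for perturbed renewal equations with geometrically dominated
distributions. -/
theorem tendsto_perturbed_renewal {α : Type*} {l : Filter α} {f g x : α → ℕ → ℝ}
    {f₀ g₀ G : ℕ → ℝ} {M r : ℝ} (hr0 : 0 ≤ r) (hr1 : r < 1) (hG : Summable G)
    (hf : ∀ᶠ a in l, (∀ n, 0 ≤ f a n) ∧ f a 0 = 0 ∧ HasSum (f a) 1 ∧ ∀ n, f a n ≤ M * r ^ n)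
    (hg : ∀ᶠ a in l, ∀ n, 0 ≤ g a n ∧ g a n ≤ G n)
    (hx : ∀ᶠ a in l, (∀ n, 0 ≤ x a n) ∧
      ∀ n, x a n = g a n + ∑ j ∈ Finset.range (n + 1), x a (n - j) * f a j)
    (hf₀ : ∀ n, 0 ≤ f₀ n) (hf₀0 : f₀ 0 = 0) (hf₀1 : HasSum f₀ 1) (hf₀M : ∀ n, f₀ n ≤ M * r ^ n)
    (hper : NonPeriodic f₀)
    (hft : ∀ n, Tendsto (fun a => f a n) l (𝓝 (f₀ n)))
    (hgt : ∀ n, Tendsto (fun a => g a n) l (𝓝 (g₀ n)))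
    {N : α → ℕ} (hN : Tendsto N l atTop) :
    Tendsto (fun a => x a (N a)) l (𝓝 ((∑' n, g₀ n) / ∑' n : ℕ, n * f₀ n)) := by
  -- Along an ultrafilter every bounded family converges, so all shifts X a (N a + k) have limits w
  -- k at once. This replaces a diagonal extraction of subsequences.
  rw [tendsto_iff_ultrafilter]
  intro U hU
  have hf := hf.filter_mono hU
  have hg := hg.filter_mono hU
  have hx := hx.filter_mono hU
  have hft := fun n => (hft n).mono_left hU
  have hgt := fun n => (hgt n).mono_left hU
  have hN := hN.mono_left hU
  clear hU
  set C := ∑' n, G n with hC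
  set X : α → ℤ → ℝ := fun a => extendZero (x a) with hXdef
  have hXC : ∀ᶠ a in (U : Filter α), ∀ n, X a n ∈ Set.Icc 0 C := by
    filter_upwards [hf, hg, hx] with a ⟨h1, h2, h3, _⟩ h4 ⟨h5, h6⟩ n
    have hle := renewal_le h1 h2 h3 hG h4 h5 h6
    simp only [hXdef, extendZero]
    split_ifs
    · exact ⟨h5 _, hle _⟩
    · exact ⟨le_rfl, (h5 0).trans (hle 0)⟩
  have hlim : ∀ k : ℤ, ∃ y ∈ Set.Icc (0 : ℝ) C, Tendsto (fun a => X a (N a + k)) U (𝓝 y) := by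
    intro k
    obtain ⟨y, hy, hle⟩ := isCompact_Icc.ultrafilter_le_nhds'
      (U.map fun a => X a (N a + k)) (by
        rw [Ultrafilter.mem_map]
        exact hXC.mono fun a ha => ha _)
    exact ⟨y, hy, hle⟩
  choose w hwC hw using hlim
  have hC0 : 0 ≤ C := (hwC 0).1.trans (hwC 0).2
  have hwabs : ∀ k, |w k| ≤ C := fun k => by
    rw [abs_of_nonneg (hwC k).1]; exact (hwC k).2
  have hgeo : Summable fun n : ℕ => M * r ^ n := (summable_geometric_of_lt_one hr0 hr1).mul_left M
  -- The renewal equation at N a + k passes to the limit by dominated convergence; the forcing term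
  -- disappears because its index tends to infinity while G is summable.
  have hharm : ∀ k : ℤ, w k = ∑' j : ℕ, f₀ j * w (k - j) := by
    intro k
    have hNk : Tendsto (fun a => ((N a : ℤ) + k).toNat) U atTop := by
      refine tendsto_atTop.2 fun b => ?_
      filter_upwards [hN.eventually_ge_atTop (b + k.natAbs)] with a ha
      omega
    have h1 : Tendsto (fun a => ∑' j : ℕ, f a j * X a (N a + (k - j))) U
        (𝓝 (∑' j : ℕ, f₀ j * w (k - j))) := by
      refine tendsto_tsum_of_dominated_convergence (hgeo.mul_right C)
        (fun j => (hft j).mul (hw _)) ?_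
      filter_upwards [hf, hXC] with a ⟨h1, _, _, h4⟩ h5 j
      rw [norm_mul, Real.norm_of_nonneg (h1 j), Real.norm_of_nonneg (h5 _).1]
      exact mul_le_mul (h4 j) (h5 _).2 (h5 _).1 ((h1 j).trans (h4 j))
    have h2 : Tendsto (fun a => g a ((N a : ℤ) + k).toNat) U (𝓝 0) := by
      refine squeeze_zero' (hg.mono fun a ha => (ha _).1) (hg.mono fun a ha => (ha _).2) ?_
      exact hG.tendsto_atTop_zero.comp hNk
    have h3 := h2.add h1
    rw [zero_add] at h3
    refine tendsto_nhds_unique (hw k) (h3.congr' ?_)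
    filter_upwards [hx, hN.eventually_ge_atTop k.natAbs] with a ⟨_, h6⟩ ha
    obtain ⟨m, hm⟩ : ∃ m : ℕ, (N a : ℤ) + k = m := ⟨((N a : ℤ) + k).toNat, by omega⟩
    simp only [← add_sub_assoc, hm, hXdef]
    rw [tsum_mul_extendZero, extendZero, if_pos (by omega), Int.toNat_natCast, h6 m]
    simp only [mul_comm]
  have hconst := harmonic_const hf₀ hf₀1 hper hwabs hharm
  have htail : Tendsto (fun a => ∑' j : ℕ, renewalTail (f a) j * X a (N a + -j)) U
      (𝓝 (∑' j : ℕ, renewalTail f₀ j * w (-j))) := by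
    refine tendsto_tsum_of_dominated_convergence (bound := fun j => M * r / (1 - r) * r ^ j * C)
      (((summable_geometric_of_lt_one hr0 hr1).mul_left _).mul_right C)
      (fun j => (tendsto_const_nhds.sub (tendsto_finsetSum _ fun i _ => hft i)).mul (hw _)) ?_
    filter_upwards [hf, hXC] with a ⟨h1, _, h3, h4⟩ h5 j
    have h6 := renewalTail_nonneg h1 h3 j
    have h7 := renewalTail_le h3 hr0 hr1 h4 j
    rw [norm_mul, Real.norm_of_nonneg h6, Real.norm_of_nonneg (h5 _).1]
    exact mul_le_mul h7 (h5 _).2 (h5 _).1 (h6.trans h7)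
  have hgsum : Tendsto (fun a => ∑' j : ℕ, if j < N a + 1 then g a j else 0) U
      (𝓝 (∑' j, g₀ j)) := by
    refine tendsto_tsum_of_dominated_convergence hG (fun j => ?_) ?_
    · refine (hgt j).congr' ?_
      filter_upwards [hN.eventually_ge_atTop j] with a ha
      rw [if_pos (by omega)]
    · filter_upwards [hg] with a ha j
      split_ifs
      · rw [Real.norm_of_nonneg (ha j).1]; exact (ha j).2
      · rw [norm_zero]; exact (ha j).1.trans (ha j).2
  -- The limit of the summed renewal equation determines the constant value of w, independently of
  -- the ultrafilter.
  have hkey : (∑' j, renewalTail f₀ j) * w 0 = ∑' j, g₀ j := by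
    rw [← tsum_mul_right]
    simp only [hconst (-_)] at htail
    refine tendsto_nhds_unique (htail.congr' ?_) hgsum
    filter_upwards [hx] with a ⟨_, h6⟩
    simp only [hXdef, ← sub_eq_add_neg]
    rw [tsum_mul_extendZero, sum_renewalTail_mul h6, tsum_eq_sum (s := Finset.range (N a + 1))]
    · exact Finset.sum_congr rfl fun j hj => by rw [if_pos (Finset.mem_range.1 hj)]
    · exact fun j hj => if_neg fun h => hj (Finset.mem_range.2 h)
  have hmean := tsum_renewalTail hf₀ hf₀1 hr0 hr1 hf₀M
  have hpos : 0 < ∑' j, renewalTail f₀ j := by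
    have hs : Summable (renewalTail f₀) :=
      Summable.of_nonneg_of_le (renewalTail_nonneg hf₀ hf₀1) (renewalTail_le hf₀1 hr0 hr1 hf₀M)
        ((summable_geometric_of_lt_one hr0 hr1).mul_left _)
    refine hs.tsum_pos (renewalTail_nonneg hf₀ hf₀1) 0 ?_
    simp [renewalTail, hf₀0]
  rw [← hmean, ← hkey, mul_div_cancel_left₀ _ hpos.ne']
  refine (hw 0).congr fun a => ?_
  simp [hXdef, extendZero]

end PerturbedRegenerative

/-! ### Exponential moments and roots of the characteristic equation -/

namespace PerturbedRegenerative

/-- The mixed power-exponential moment `∑ n^r e^{ρ n} g(n)`. -/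
noncomputable def expMoment (g : ℕ → ℝ) (ρ : ℝ) (r : ℕ) : ℝ :=
  ∑' n : ℕ, (n : ℝ) ^ r * Real.exp (ρ * n) * g n

section

variable {g : ℕ → ℝ} {δ M : ℝ}

theorem expMoment_term_nonneg (h0 : ∀ n, 0 ≤ g n) (ρ : ℝ) (r n : ℕ) :
    0 ≤ (n : ℝ) ^ r * Real.exp (ρ * n) * g n :=
  mul_nonneg (by positivity) (h0 n)

theorem expMoment_term_le (h0 : ∀ n, 0 ≤ g n) (hM : ∀ n : ℕ, Real.exp (δ * n) * g n ≤ M)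
    {ρ β : ℝ} (hρ : ρ ≤ β) (r n : ℕ) :
    (n : ℝ) ^ r * Real.exp (ρ * n) * g n ≤ M * ((n : ℝ) ^ r * Real.exp (-(δ - β) * n)) := by
  have h1 : Real.exp (ρ * n) ≤ Real.exp (-(δ - β) * n) * Real.exp (δ * n) := by
    rw [← Real.exp_add, Real.exp_le_exp]
    nlinarith [n.cast_nonneg (α := ℝ)]
  calc (n : ℝ) ^ r * Real.exp (ρ * n) * g n
      ≤ (n : ℝ) ^ r * (Real.exp (-(δ - β) * n) * Real.exp (δ * n)) * g n := by
        gcongr; exact h0 n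
    _ = (n : ℝ) ^ r * Real.exp (-(δ - β) * n) * (Real.exp (δ * n) * g n) := by ring
    _ ≤ (n : ℝ) ^ r * Real.exp (-(δ - β) * n) * M := by gcongr; exact hM n
    _ = _ := by ring

theorem summable_expMoment_bound (M : ℝ) {β : ℝ} (hβ : β < δ) (r : ℕ) :
    Summable fun n : ℕ => M * ((n : ℝ) ^ r * Real.exp (-(δ - β) * n)) :=
  (Real.summable_pow_mul_exp_neg_nat_mul r (sub_pos.2 hβ)).mul_left M

theorem summable_expMoment (h0 : ∀ n, 0 ≤ g n) (hM : ∀ n : ℕ, Real.exp (δ * n) * g n ≤ M)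
    {ρ : ℝ} (hρ : ρ < δ) (r : ℕ) :
    Summable fun n : ℕ => (n : ℝ) ^ r * Real.exp (ρ * n) * g n :=
  Summable.of_nonneg_of_le (expMoment_term_nonneg h0 ρ r)
    (expMoment_term_le h0 hM le_rfl r) (summable_expMoment_bound M hρ r)

theorem expMoment_mono (h0 : ∀ n, 0 ≤ g n) {ρ₁ ρ₂ : ℝ} (h : ρ₁ ≤ ρ₂) {r : ℕ}
    (hs : Summable fun n : ℕ => (n : ℝ) ^ r * Real.exp (ρ₂ * n) * g n) :
    (Summable fun n : ℕ => (n : ℝ) ^ r * Real.exp (ρ₁ * n) * g n) ∧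
      expMoment g ρ₁ r ≤ expMoment g ρ₂ r := by
  have hle : ∀ n : ℕ, (n : ℝ) ^ r * Real.exp (ρ₁ * n) * g n
      ≤ (n : ℝ) ^ r * Real.exp (ρ₂ * n) * g n := fun n => by gcongr; exact h0 n
  have hs1 := Summable.of_nonneg_of_le (expMoment_term_nonneg h0 ρ₁ r) hle hs
  exact ⟨hs1, hs1.tsum_le_tsum hle hs⟩

theorem expMoment_strictMono (h0 : ∀ n, 0 ≤ g n) (hpos : ∃ n, n ≠ 0 ∧ 0 < g n) {ρ₁ ρ₂ : ℝ}
    (h : ρ₁ < ρ₂) {r : ℕ}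
    (hs : Summable fun n : ℕ => (n : ℝ) ^ r * Real.exp (ρ₂ * n) * g n) :
    expMoment g ρ₁ r < expMoment g ρ₂ r := by
  obtain ⟨m, hm, hgm⟩ := hpos
  refine Summable.tsum_lt_tsum (i := m) (fun n => ?_) ?_ (expMoment_mono h0 h.le hs).1 hs
  · have := h0 n
    dsimp only
    gcongr
  · have : (0 : ℝ) < m := by positivity
    gcongr

/-- A divergent series has `tsum` equal to 0, so the value 1 forces convergence. -/
theorem summable_of_expMoment_eq_one {ρ : ℝ} {r : ℕ} (h : expMoment g ρ r = 1) :
    Summable fun n : ℕ => (n : ℝ) ^ r * Real.exp (ρ * n) * g n := by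
  by_contra hs
  rw [expMoment, tsum_eq_zero_of_not_summable hs] at h
  exact zero_ne_one h

theorem expMoment_root_unique (h0 : ∀ n, 0 ≤ g n) (hpos : ∃ n, n ≠ 0 ∧ 0 < g n) {ρ₁ ρ₂ : ℝ}
    (h₁ : expMoment g ρ₁ 0 = 1) (h₂ : expMoment g ρ₂ 0 = 1) : ρ₁ = ρ₂ := by
  rcases lt_trichotomy ρ₁ ρ₂ with h | h | h
  · have := expMoment_strictMono h0 hpos h (summable_of_expMoment_eq_one h₂)
    rw [h₁, h₂] at this; exact absurd this (lt_irrefl _)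
  · exact h
  · have := expMoment_strictMono h0 hpos h (summable_of_expMoment_eq_one h₁)
    rw [h₁, h₂] at this; exact absurd this (lt_irrefl _)

theorem exists_expMoment_root (h0 : ∀ n, 0 ≤ g n) {β : ℝ} (hβ : 0 ≤ β)
    (hs : Summable fun n : ℕ => (n : ℝ) ^ 0 * Real.exp (β * n) * g n)
    (hlow : expMoment g 0 0 ≤ 1) (hhigh : 1 < expMoment g β 0) :
    ∃ ρ, 0 ≤ ρ ∧ ρ < β ∧ expMoment g ρ 0 = 1 := by
  have hc : ContinuousOn (fun ρ => expMoment g ρ 0) (Set.Icc 0 β) := by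
    refine continuousOn_tsum (fun n => by fun_prop) hs fun n ρ hρ => ?_
    rw [Real.norm_of_nonneg (expMoment_term_nonneg h0 ρ 0 n)]
    have := h0 n
    have := hρ.2
    gcongr
  obtain ⟨ρ, hρ, h⟩ := intermediate_value_Icc hβ hc ⟨hlow, hhigh.le⟩
  refine ⟨ρ, hρ.1, lt_of_le_of_ne hρ.2 ?_, h⟩
  rintro rfl
  exact hhigh.ne' h

theorem abs_exp_sub_sum_le (x : ℝ) (n : ℕ) :
    |Real.exp x - ∑ m ∈ Finset.range n, x ^ m / m.factorial| ≤ |x| ^ n * Real.exp |x| := by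
  have h := Complex.norm_exp_sub_sum_le_norm_mul_exp (x : ℂ) n
  have e : Complex.exp (x : ℂ) - ∑ m ∈ Finset.range n, (x : ℂ) ^ m / m.factorial
      = ((Real.exp x - ∑ m ∈ Finset.range n, x ^ m / m.factorial : ℝ) : ℂ) := by push_cast; rfl
  rwa [e, Complex.norm_real, Complex.norm_real] at h

/-- Taylor's formula for the moment generating function. -/
theorem expMoment_taylor (h0 : ∀ n, 0 ≤ g n) (hM : ∀ n : ℕ, Real.exp (δ * n) * g n ≤ M)
    {ρ Δ : ℝ} (hρ : ρ + |Δ| < δ) (k : ℕ) :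
    |expMoment g (ρ + Δ) 0 - ∑ r ∈ Finset.range (k + 1), Δ ^ r / r.factorial * expMoment g ρ r|
      ≤ |Δ| ^ (k + 1) * expMoment g (ρ + |Δ|) (k + 1) := by
  have hρ0 : ρ < δ := by linarith [abs_nonneg Δ]
  have hs1 := (summable_expMoment h0 hM (ρ := ρ + Δ) (by linarith [le_abs_self Δ]) 0).hasSum
  have hs2 : HasSum (fun n : ℕ => ∑ r ∈ Finset.range (k + 1),
      Δ ^ r / r.factorial * ((n : ℝ) ^ r * Real.exp (ρ * n) * g n))
      (∑ r ∈ Finset.range (k + 1), Δ ^ r / r.factorial * expMoment g ρ r) :=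
    hasSum_sum fun r _ => (summable_expMoment h0 hM hρ0 r).hasSum.mul_left _
  have hs3 := (summable_expMoment h0 hM hρ (k + 1)).hasSum.mul_left (|Δ| ^ (k + 1))
  have hs := hs1.sub hs2
  change |∑' n : ℕ, (n : ℝ) ^ 0 * Real.exp ((ρ + Δ) * n) * g n - _| ≤
    |Δ| ^ (k + 1) * ∑' n : ℕ, (n : ℝ) ^ (k + 1) * Real.exp ((ρ + |Δ|) * n) * g n
  rw [← hs.tsum_eq, ← hs3.tsum_eq, ← Real.norm_eq_abs]
  refine tsum_of_norm_bounded hs3.summable.hasSum fun n => ?_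
  have e : (n : ℝ) ^ 0 * Real.exp ((ρ + Δ) * n) * g n
      - ∑ r ∈ Finset.range (k + 1), Δ ^ r / r.factorial * ((n : ℝ) ^ r * Real.exp (ρ * n) * g n)
      = (Real.exp (ρ * n) * g n) *
        (Real.exp (Δ * n) - ∑ r ∈ Finset.range (k + 1), (Δ * n) ^ r / r.factorial) := by
    rw [mul_sub, Finset.mul_sum, pow_zero, one_mul, add_mul, Real.exp_add]
    congr 1
    · ring
    · exact Finset.sum_congr rfl fun r _ => by rw [mul_pow]; ring
  have hnn : 0 ≤ Real.exp (ρ * n) * g n := mul_nonneg (Real.exp_pos _).le (h0 n)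
  rw [e, norm_mul, Real.norm_of_nonneg hnn, Real.norm_eq_abs]
  refine (mul_le_mul_of_nonneg_left (abs_exp_sub_sum_le (Δ * n) (k + 1)) hnn).trans_eq ?_
  rw [abs_mul, Nat.abs_cast, mul_pow, add_mul, Real.exp_add]
  ring

end

section

variable {α : Type*} {l : Filter α} {f : α → ℕ → ℝ} {f₀ : ℕ → ℝ} {δ M : ℝ}

theorem tendsto_expMoment
    (hf : ∀ᶠ a in l, (∀ n, 0 ≤ f a n) ∧ ∀ n : ℕ, Real.exp (δ * n) * f a n ≤ M)
    (hft : ∀ n, Tendsto (fun a => f a n) l (𝓝 (f₀ n))) {ρ : α → ℝ} {ρ₀ : ℝ} (hρ₀ : ρ₀ < δ)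
    (hρ : Tendsto ρ l (𝓝 ρ₀)) (r : ℕ) :
    Tendsto (fun a => expMoment (f a) (ρ a) r) l (𝓝 (expMoment f₀ ρ₀ r)) := by
  obtain ⟨β, h1, h2⟩ := exists_between hρ₀
  refine tendsto_tsum_of_dominated_convergence (summable_expMoment_bound M h2 r) (fun n => ?_) ?_
  · exact ((hρ.mul_const _).rexp.const_mul _).mul (hft n)
  · filter_upwards [hf, hρ.eventually_lt_const h1] with a ⟨h3, h4⟩ h5 n
    rw [Real.norm_of_nonneg (expMoment_term_nonneg h3 _ _ _)]
    exact expMoment_term_le h3 h4 h5.le r n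

/-- The limit moment function lies strictly below 1 to the left of ρ₀ and strictly above 1 to its
right. Pointwise convergence carries these inequalities to nearby parameters, and monotonicity traps
the root. -/
theorem tendsto_expMoment_root
    (hf : ∀ᶠ a in l, (∀ n, 0 ≤ f a n) ∧ ∀ n : ℕ, Real.exp (δ * n) * f a n ≤ M)
    (hf₀ : ∀ n, 0 ≤ f₀ n) (hf₀M : ∀ n : ℕ, Real.exp (δ * n) * f₀ n ≤ M)
    (hpos : ∃ n, n ≠ 0 ∧ 0 < f₀ n)
    (hft : ∀ n, Tendsto (fun a => f a n) l (𝓝 (f₀ n))) {ρ : α → ℝ} {ρ₀ : ℝ} (hρ₀ : ρ₀ < δ)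
    (hroot₀ : expMoment f₀ ρ₀ 0 = 1) (hroot : ∀ᶠ a in l, expMoment (f a) (ρ a) 0 = 1) :
    Tendsto ρ l (𝓝 ρ₀) := by
  refine tendsto_order.2 ⟨fun b hb => ?_, fun b hb => ?_⟩
  · have h1 : expMoment f₀ b 0 < 1 :=
      hroot₀ ▸ expMoment_strictMono hf₀ hpos hb (summable_expMoment hf₀ hf₀M hρ₀ 0)
    filter_upwards [hf, hroot, (tendsto_expMoment hf hft (hb.trans hρ₀) tendsto_const_nhds
      0).eventually_lt_const h1] with a ⟨h2, h3⟩ h4 h5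
    by_contra! h6
    have := (expMoment_mono h2 h6 (summable_expMoment h2 h3 (hb.trans hρ₀) 0)).2
    linarith
  -- The comparison point must also stay below δ, where the moments are known to converge.
  · obtain ⟨β, h1, h2⟩ := exists_between (lt_min hb hρ₀)
    have h2' := h2.trans_le (min_le_right _ _)
    have h3 : 1 < expMoment f₀ β 0 :=
      hroot₀ ▸ expMoment_strictMono hf₀ hpos h1 (summable_expMoment hf₀ hf₀M h2' 0)
    filter_upwards [hf, hroot, (tendsto_expMoment hf hft h2' tendsto_const_nhds
      0).eventually_const_lt h3] with a ⟨h4, _⟩ h5 h6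
    by_contra! h7
    have := (expMoment_mono h4 ((h2.trans_le (min_le_left _ _)).le.trans h7)
      (summable_of_expMoment_eq_one h5)).2
    linarith

/-- The Taylor expansion of the characteristic equation is uniform in the parameter. -/
theorem one_sub_taylor_isBigO
    (hf : ∀ᶠ a in l, (∀ n, 0 ≤ f a n) ∧ ∀ n : ℕ, Real.exp (δ * n) * f a n ≤ M)
    (hft : ∀ n, Tendsto (fun a => f a n) l (𝓝 (f₀ n))) {ρ : α → ℝ} {ρ₀ : ℝ} (hρ₀ : ρ₀ < δ)
    (hroot : ∀ᶠ a in l, expMoment (f a) (ρ a) 0 = 1) (hρ : Tendsto ρ l (𝓝 ρ₀)) (k : ℕ) :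
    (fun a => 1 - ∑ r ∈ Finset.range (k + 1),
        (ρ a - ρ₀) ^ r / r.factorial * expMoment (f a) ρ₀ r)
      =O[l] fun a => (ρ a - ρ₀) ^ (k + 1) := by
  have hΔ : Tendsto (fun a => ρ₀ + |ρ a - ρ₀|) l (𝓝 ρ₀) := by
    simpa using (hρ.sub_const ρ₀).abs.const_add ρ₀
  -- The Taylor remainder involves the moment at ρ₀ + |ρ a − ρ₀|, which converges and is therefore
  -- bounded.
  have hb := (tendsto_expMoment hf hft hρ₀ hΔ (k + 1)).isBigO_one ℝ
  have hO : (fun a => 1 - ∑ r ∈ Finset.range (k + 1),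
        (ρ a - ρ₀) ^ r / r.factorial * expMoment (f a) ρ₀ r)
      =O[l] fun a => (ρ a - ρ₀) ^ (k + 1) * expMoment (f a) (ρ₀ + |ρ a - ρ₀|) (k + 1) := by
    refine IsBigO.of_bound 1 ?_
    filter_upwards [hf, hroot, hΔ.eventually_lt_const hρ₀] with a ⟨h1, h2⟩ h3 h4
    have := expMoment_taylor h1 h2 h4 k
    rw [add_sub_cancel, h3] at this
    rw [Real.norm_eq_abs, norm_mul, norm_pow, one_mul, Real.norm_eq_abs, Real.norm_eq_abs]
    exact this.trans (mul_le_mul_of_nonneg_left (le_abs_self _) (by positivity))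
  simpa using hO.trans ((isBigO_refl _ _).mul hb)

end

end PerturbedRegenerative

/-! ### The coefficient recursion as a polynomial identity -/

namespace PerturbedRegenerative

/-- A recursion on all smaller indices has a solution. -/
theorem exists_eq_of_strong_recursion (R : ℕ → (ℕ → ℝ) → ℝ)
    (hR : ∀ n c c', (∀ p < n, c p = c' p) → R n c = R n c') :
    ∃ c : ℕ → ℝ, ∀ n, c n = R n c := by
  let F : (n : ℕ) → ((m : ℕ) → m < n → ℝ) → ℝ :=
    fun n h => R n fun m => if hm : m < n then h m hm else 0
  let c : ℕ → ℝ := fun n => Nat.strongRec F n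
  refine ⟨c, fun n => ?_⟩
  have h : c n = F n fun m _ => c m := by
    simp only [c]; rw [Nat.strongRec_eq]
  rw [h]
  refine hR _ _ _ fun p hp => ?_
  simp [hp]

theorem exists_coeffRecursion (k : ℕ) (a : ℕ → ℕ → ℝ) : ∃ c, CoeffRecursion k a c := by
  obtain ⟨c, hc⟩ := exists_eq_of_strong_recursion
    (fun n c => -(1 / a 0 1) *
      (a n 0 + ∑ q ∈ Finset.Icc 1 (n - 1), a (n - q) 1 * c q
        + ∑ m ∈ Finset.Icc 2 n, ∑ q ∈ Finset.Icc m n, a (n - q) m *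
            ∑ v ∈ D m q, ∏ p ∈ Finset.Icc 1 (q - 1), c p ^ v p / (Nat.factorial (v p) : ℝ)))
    (fun n c c' h => by
      congr 2
      · congr 1
        refine Finset.sum_congr rfl fun q hq => ?_
        rw [Finset.mem_Icc] at hq
        rw [h q (by omega)]
      · refine Finset.sum_congr rfl fun m hm => Finset.sum_congr rfl fun q hq => ?_
        rw [Finset.mem_Icc] at hm hq
        congr 1
        refine Finset.sum_congr rfl fun v _ => Finset.prod_congr rfl fun p hp => ?_
        rw [Finset.mem_Icc] at hp
        rw [h p (by omega)])
  -- For n = 1 all the sums of the general step are empty, so it reduces to the separate formula for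
  -- c 1.
  refine ⟨c, fun _ => ?_, fun n _ _ => hc n⟩
  rw [hc 1]
  simp
  ring

open Polynomial in
/-- The polynomial `c 1 X + ⋯ + c k X ^ k`. -/
noncomputable def coeffPoly (k : ℕ) (c : ℕ → ℝ) : ℝ[X] :=
  ∑ i ∈ Finset.Icc 1 k, C (c i) * X ^ i

theorem coeffPoly_coeff (k : ℕ) (c : ℕ → ℝ) (q : ℕ) :
    (coeffPoly k c).coeff q = if q ∈ Finset.Icc 1 k then c q else 0 := by
  simp only [coeffPoly, Polynomial.finsetSum_coeff, Polynomial.coeff_C_mul_X_pow]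
  rw [Finset.sum_ite_eq]

theorem coeffPoly_pow_coeff_of_lt {k : ℕ} {c : ℕ → ℝ} {m q : ℕ} (h : q < m) :
    (coeffPoly k c ^ m).coeff q = 0 := by
  have h1 : (Polynomial.X : Polynomial ℝ) ∣ coeffPoly k c :=
    Finset.dvd_sum fun i hi => by
      rw [Finset.mem_Icc] at hi
      exact Dvd.dvd.mul_left (dvd_pow_self _ (by omega)) _
  exact Polynomial.X_pow_dvd_iff.1 (pow_dvd_pow_of_dvd h1 m) q h

/-- The multinomial formula for the coefficients of the powers of a polynomial, indexed by
`D m q`. -/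
theorem coeffPoly_pow_coeff {k : ℕ} {c : ℕ → ℝ} {m q : ℕ} (hm : 2 ≤ m) (hq : q ≤ k) :
    1 / (m.factorial : ℝ) * (coeffPoly k c ^ m).coeff q =
      ∑ v ∈ D m q, ∏ p ∈ Finset.Icc 1 (q - 1), c p ^ v p / (Nat.factorial (v p) : ℝ) := by
  have hsub : Finset.Icc 1 (q - 1) ⊆ Finset.Icc 1 k :=
    Finset.Icc_subset_Icc le_rfl (by omega)
  have hD : D m q = ((Finset.Icc 1 k).piAntidiag m).filter
      fun v => ∑ p ∈ Finset.Icc 1 k, p * v p = q := by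
    ext v
    rw [mem_D, Finset.mem_filter, Finset.mem_piAntidiag]
    constructor
    · rintro ⟨h1, h2, h3⟩
      refine ⟨⟨?_, fun p hp => hsub (by_contra fun h => hp (h1 p h))⟩, ?_⟩
      · rw [← h2]; exact (Finset.sum_subset hsub fun p _ hp => h1 p hp).symm
      · rw [← h3]
        exact (Finset.sum_subset hsub fun p _ hp => by rw [h1 p hp, mul_zero]).symm
    · rintro ⟨⟨h1, h2⟩, h3⟩
      -- This uses m ≥ 2: if v p > 0, then the weighted sum q is at least p + (m − 1) ≥ p + 1, so
      -- only indices p ≤ q − 1 occur.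
      have h0 : ∀ p, p ∉ Finset.Icc 1 (q - 1) → v p = 0 := by
        intro p hp
        by_contra hv
        have hpk := h2 p hv
        have e1 := Finset.add_sum_erase _ v hpk
        have e2 := Finset.add_sum_erase _ (fun p => p * v p) hpk
        have e3 : ∑ i ∈ (Finset.Icc 1 k).erase p, v i ≤ ∑ i ∈ (Finset.Icc 1 k).erase p, i * v i :=
          Finset.sum_le_sum fun i hi => by
            have := (Finset.mem_Icc.1 (Finset.mem_of_mem_erase hi)).1
            exact Nat.le_mul_of_pos_left _ this
        rw [Finset.mem_Icc] at hp hpk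
        obtain ⟨p', rfl⟩ : ∃ p', p = p' + 1 := ⟨p - 1, by omega⟩
        have hv1 : 1 ≤ v (p' + 1) := Nat.one_le_iff_ne_zero.2 hv
        have h4 : p' ≤ p' * v (p' + 1) := Nat.le_mul_of_pos_right _ hv1
        have e4 : (p' + 1) * v (p' + 1) = p' * v (p' + 1) + v (p' + 1) := by ring
        rw [h1] at e1
        rw [h3, e4] at e2
        omega
      refine ⟨h0, ?_, ?_⟩
      · rw [← h1]; exact Finset.sum_subset hsub fun p _ hp => h0 p hp
      · exact (Finset.sum_subset hsub fun p _ hp => by rw [h0 p hp, mul_zero]).trans h3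
  have hprod : ∀ v ∈ D m q, ∏ p ∈ Finset.Icc 1 (q - 1), c p ^ v p / (Nat.factorial (v p) : ℝ)
      = ∏ p ∈ Finset.Icc 1 k, c p ^ v p / (Nat.factorial (v p) : ℝ) := fun v hv =>
    Finset.prod_subset hsub fun p _ hp => by rw [(mem_D.1 hv).1 p hp]; simp
  rw [Finset.sum_congr rfl hprod, hD, Finset.sum_filter, coeffPoly,
    Finset.sum_pow_eq_sum_piAntidiag, Polynomial.finsetSum_coeff, Finset.mul_sum]
  refine Finset.sum_congr rfl fun v hv => ?_
  have hv := (Finset.mem_piAntidiag.1 hv).1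
  have h1 : ∏ i ∈ Finset.Icc 1 k, (Polynomial.C (c i) * Polynomial.X ^ i) ^ v i
      = Polynomial.C (∏ i ∈ Finset.Icc 1 k, c i ^ v i) *
        Polynomial.X ^ (∑ p ∈ Finset.Icc 1 k, p * v p) := by
    simp only [mul_pow, Finset.prod_mul_distrib, ← pow_mul, Finset.prod_pow_eq_pow_sum, map_prod,
      map_pow]
  have hmult : ((∏ i ∈ Finset.Icc 1 k, ((v i).factorial : ℝ)) *
      Nat.multinomial (Finset.Icc 1 k) v) = m.factorial := by
    rw [← hv]; exact_mod_cast Nat.multinomial_spec (Finset.Icc 1 k) v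
  rw [h1, ← Polynomial.C_eq_natCast, ← mul_assoc, ← map_mul, Polynomial.coeff_C_mul_X_pow,
    Finset.prod_div_distrib]
  by_cases h : ∑ p ∈ Finset.Icc 1 k, p * v p = q
  · rw [if_pos h.symm, if_pos h, ← hmult]
    have hne : (∏ i ∈ Finset.Icc 1 k, ((v i).factorial : ℝ)) ≠ 0 :=
      Finset.prod_ne_zero_iff.2 fun i _ => by positivity
    have hne' : (Nat.multinomial (Finset.Icc 1 k) v : ℝ) ≠ 0 := by
      intro h0
      rw [h0, mul_zero] at hmult
      exact (Nat.cast_ne_zero.2 m.factorial_ne_zero) hmult.symm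
    field_simp
  · rw [if_neg (Ne.symm h), if_neg h, mul_zero]

open Polynomial in
/-- The truncated expansion of `φ` in powers of the parameter and of the increment of the
argument, with `c 1 X + ⋯ + c k X ^ k` substituted for the latter. -/
noncomputable def charPoly (k : ℕ) (a : ℕ → ℕ → ℝ) (c : ℕ → ℝ) : ℝ[X] :=
  ∑ m ∈ Finset.range (k + 1), (C (1 / (m.factorial : ℝ)) * coeffPoly k c ^ m) *
    ∑ s ∈ Finset.range (k - m + 1), C (a s m) * X ^ s

/-- `coeffPoly` has no constant term, so its m-th power contributes only in degrees q ≥ m. Then n −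
q ≤ k − m, so the truncation of the inner sum loses nothing up to degree k. -/
theorem charPoly_coeff {k : ℕ} (a : ℕ → ℕ → ℝ) (c : ℕ → ℝ) {n : ℕ} (hn : n ≤ k) :
    (charPoly k a c).coeff n = ∑ m ∈ Finset.range (n + 1), ∑ q ∈ Finset.Icc m n,
      a (n - q) m * (1 / (m.factorial : ℝ) * (coeffPoly k c ^ m).coeff q) := by
  have hinner : ∀ m s, (∑ s ∈ Finset.range (k - m + 1),
      Polynomial.C (a s m) * Polynomial.X ^ s).coeff s
      = if s ∈ Finset.range (k - m + 1) then a s m else 0 := fun m s => by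
    simp only [Polynomial.finsetSum_coeff, Polynomial.coeff_C_mul_X_pow]
    rw [Finset.sum_ite_eq]
  rw [charPoly, Polynomial.finsetSum_coeff]
  symm
  have hsub : Finset.range (n + 1) ⊆ Finset.range (k + 1) := Finset.range_mono (by omega)
  rw [← Finset.sum_subset hsub]
  · refine Finset.sum_congr rfl fun m hm => ?_
    rw [Polynomial.coeff_mul, Finset.Nat.sum_antidiagonal_eq_sum_range_succ_mk]
    have hsub' : Finset.Icc m n ⊆ Finset.range n.succ := fun q hq => by
      rw [Finset.mem_Icc] at hq; rw [Finset.mem_range]; omega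
    rw [← Finset.sum_subset hsub']
    · refine Finset.sum_congr rfl fun q hq => ?_
      rw [Finset.mem_Icc] at hq
      rw [hinner, if_pos (by rw [Finset.mem_range]; omega), Polynomial.coeff_C_mul, mul_comm]
    · intro q hq hq'
      rw [Finset.mem_range] at hq
      rw [Finset.mem_Icc] at hq'
      rw [Polynomial.coeff_C_mul, coeffPoly_pow_coeff_of_lt (by omega), mul_zero, zero_mul]
  · intro m _ hm
    rw [Finset.mem_range] at hm
    rw [Polynomial.coeff_mul]
    refine Finset.sum_eq_zero fun q hq => ?_
    have := Finset.HasAntidiagonal.mem_antidiagonal.1 hq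
    rw [Polynomial.coeff_C_mul, coeffPoly_pow_coeff_of_lt (by omega), mul_zero, zero_mul]

/-- The recursion makes the coefficients of the expanded characteristic equation vanish. -/
theorem X_pow_dvd_charPoly_sub_one {k : ℕ} {a : ℕ → ℕ → ℝ} {c : ℕ → ℝ} (h00 : a 0 0 = 1)
    (h01 : 1 ≤ k → a 0 1 ≠ 0) (hc : CoeffRecursion k a c) :
    (Polynomial.X : Polynomial ℝ) ^ (k + 1) ∣ charPoly k a c - 1 := by
  rw [Polynomial.X_pow_dvd_iff]
  intro n hn
  have hn : n ≤ k := by omega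
  rw [Polynomial.coeff_sub, charPoly_coeff a c hn, Polynomial.coeff_one]
  rcases Nat.eq_zero_or_pos n with rfl | hpos
  · simp [h00]
  have h0 : ∑ q ∈ Finset.Icc 0 n,
      a (n - q) 0 * (1 / (Nat.factorial 0 : ℝ) * (coeffPoly k c ^ 0).coeff q) = a n 0 := by
    rw [Finset.sum_eq_single 0]
    · simp
    · intro q _ hq; simp [Polynomial.coeff_one, hq]
    · intro h; simp at h
  -- The linear part m = 1 is the only place where c n occurs; its coefficient `a 0 1` is what the
  -- recursion divides by.
  have h1 : ∑ q ∈ Finset.Icc 1 n,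
      a (n - q) 1 * (1 / (Nat.factorial 1 : ℝ) * (coeffPoly k c ^ 1).coeff q)
      = ∑ q ∈ Finset.Icc 1 (n - 1), a (n - q) 1 * c q + a 0 1 * c n := by
    obtain ⟨n', rfl⟩ : ∃ n', n = n' + 1 := ⟨n - 1, by omega⟩
    rw [Finset.sum_Icc_succ_top (by omega), Nat.add_sub_cancel]
    congr 1
    · refine Finset.sum_congr rfl fun q hq => ?_
      rw [Finset.mem_Icc] at hq
      rw [pow_one, coeffPoly_coeff, if_pos (by rw [Finset.mem_Icc]; omega)]
      simp
    · rw [pow_one, coeffPoly_coeff, if_pos (by rw [Finset.mem_Icc]; omega)]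
      simp
  have h2 : ∑ m ∈ Finset.range (n + 1), ∑ q ∈ Finset.Icc m n,
      a (n - q) m * (1 / (m.factorial : ℝ) * (coeffPoly k c ^ m).coeff q)
      = a n 0 + (∑ q ∈ Finset.Icc 1 (n - 1), a (n - q) 1 * c q + a 0 1 * c n) +
        ∑ m ∈ Finset.Icc 2 n, ∑ q ∈ Finset.Icc m n, a (n - q) m *
            ∑ v ∈ D m q, ∏ p ∈ Finset.Icc 1 (q - 1), c p ^ v p / (Nat.factorial (v p) : ℝ) := by
    have hr : Finset.range (n + 1) = insert 0 (insert 1 (Finset.Icc 2 n)) := by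
      ext i; simp only [Finset.mem_range, Finset.mem_insert, Finset.mem_Icc]; omega
    rw [hr, Finset.sum_insert (by simp), Finset.sum_insert (by simp), h0, h1, ← add_assoc]
    congr 1
    refine Finset.sum_congr rfl fun m hm => Finset.sum_congr rfl fun q hq => ?_
    rw [Finset.mem_Icc] at hm hq
    rw [coeffPoly_pow_coeff hm.1 (hq.2.trans hn)]
  have ha := h01 (by omega)
  have hrec : a 0 1 * c n = -(a n 0 + ∑ q ∈ Finset.Icc 1 (n - 1), a (n - q) 1 * c q
        + ∑ m ∈ Finset.Icc 2 n, ∑ q ∈ Finset.Icc m n, a (n - q) m *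
            ∑ v ∈ D m q, ∏ p ∈ Finset.Icc 1 (q - 1),
              c p ^ v p / (Nat.factorial (v p) : ℝ)) := by
    rcases (show n = 1 ∨ 2 ≤ n by omega) with rfl | h
    · rw [hc.one (by omega)]
      simp
      field_simp
    · rw [hc.step n h hn]
      field_simp
  rw [h2, hrec, if_neg (by omega)]
  ring

end PerturbedRegenerative

/-! ### Asymptotic inversion of the perturbed equation -/

namespace PerturbedRegenerative

section

variable {α : Type*} {l : Filter α} {x Δ : α → ℝ}

theorem isLittleO_pow_of_lt (hx : Tendsto x l (𝓝 0)) {m n : ℕ} (h : m < n) :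
    (fun t => x t ^ n) =o[l] fun t => x t ^ m :=
  (isLittleO_pow_pow (𝕜 := ℝ) h).comp_tendsto hx

theorem isBigO_pow_of_le (hx : Tendsto x l (𝓝 0)) {m n : ℕ} (h : m ≤ n) :
    (fun t => x t ^ n) =O[l] fun t => x t ^ m := by
  rcases h.eq_or_lt with rfl | h
  · exact isBigO_refl _ _
  · exact (isLittleO_pow_of_lt hx h).isBigO

theorem tendsto_sum_mul_pow (hx : Tendsto x l (𝓝 0)) (b : ℕ → ℝ) (n : ℕ) :
    Tendsto (fun t => ∑ i ∈ Finset.range (n + 1), b i * x t ^ i) l (𝓝 (b 0)) := by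
  have h : Tendsto (fun y : ℝ => ∑ i ∈ Finset.range (n + 1), b i * y ^ i) (𝓝 0) (𝓝 (b 0)) := by
    have : Continuous fun y : ℝ => ∑ i ∈ Finset.range (n + 1), b i * y ^ i := by fun_prop
    have h0 := this.tendsto 0
    rwa [Finset.sum_range_succ', Finset.sum_eq_zero (fun i _ => by simp), zero_add, pow_zero,
      mul_one] at h0
  exact h.comp hx

theorem tendsto_of_isLittleO_expansion (hx : Tendsto x l (𝓝 0)) {b : α → ℝ} {β : ℕ → ℝ} {n : ℕ}
    (h : (fun t => b t - ∑ i ∈ Finset.range (n + 1), β i * x t ^ i) =o[l] fun t => x t ^ n) :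
    Tendsto b l (𝓝 (β 0)) := by
  have h1 : Tendsto (fun t => b t - ∑ i ∈ Finset.range (n + 1), β i * x t ^ i) l (𝓝 0) := by
    have h2 : (fun t => x t ^ n) =O[l] fun _ => (1 : ℝ) := by
      simpa using isBigO_pow_of_le hx (Nat.zero_le n)
    exact (isLittleO_one_iff ℝ).1 (h.trans_isBigO h2)
  simpa using h1.add (tendsto_sum_mul_pow hx β n)

theorem isBigO_mul_of_tendsto_ne_zero {u H : α → ℝ} {y : ℝ} (hH : Tendsto H l (𝓝 y)) (hy : y ≠ 0) :
    u =O[l] fun t => u t * H t := by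
  have h1 : (fun t => u t * H t * (H t)⁻¹) =O[l] fun t => u t * H t * 1 :=
    (isBigO_refl _ _).mul ((hH.inv₀ hy).isBigO_one ℝ)
  simp only [mul_one] at h1
  refine h1.congr' ?_ EventuallyEq.rfl
  filter_upwards [hH.eventually_ne hy] with t ht
  rw [mul_assoc, mul_inv_cancel₀ ht, mul_one]

/-- Splitting off the r = 0 term gives 1 − b₀ = ΔH + E with H → `a 0 1` ≠ 0 and E = o(Δ). The left
side is O(x) because `a 0 0` = 1, so Δ inherits this order. -/
theorem isBigO_of_root {b : α → ℕ → ℝ} {a : ℕ → ℕ → ℝ} {k : ℕ} (hk : 1 ≤ k)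
    (hx : Tendsto x l (𝓝 0)) (hΔ : Tendsto Δ l (𝓝 0))
    (hb : ∀ r ≤ k, (fun t => b t r - ∑ n ∈ Finset.range (k - r + 1), a n r * x t ^ n)
      =o[l] fun t => x t ^ (k - r))
    (hT : (fun t => 1 - ∑ r ∈ Finset.range (k + 1), Δ t ^ r / r.factorial * b t r)
      =O[l] fun t => Δ t ^ (k + 1))
    (h00 : a 0 0 = 1) (h01 : a 0 1 ≠ 0) : Δ =O[l] x := by
  set H : α → ℝ := fun t => ∑ r ∈ Finset.range k, Δ t ^ r / (r + 1).factorial * b t (r + 1) with hH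
  set E : α → ℝ := fun t => 1 - ∑ r ∈ Finset.range (k + 1), Δ t ^ r / r.factorial * b t r with hE
  have hHt : Tendsto H l (𝓝 (a 0 1)) := by
    have h1 : Tendsto H l (𝓝 (∑ r ∈ Finset.range k,
        (0 : ℝ) ^ r / (r + 1).factorial * a 0 (r + 1))) :=
      tendsto_finsetSum _ fun r hr => by
        have := Finset.mem_range.1 hr
        exact ((hΔ.pow r).div_const _).mul
          (tendsto_of_isLittleO_expansion hx (β := fun n => a n (r + 1)) (hb (r + 1) (by omega)))
    rwa [Finset.sum_eq_single_of_mem 0 (Finset.mem_range.2 hk)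
      (fun r _ hr => by rw [zero_pow hr]; simp), pow_zero, zero_add, Nat.factorial_one,
      Nat.cast_one, div_one, one_mul] at h1
  have hEo : E =o[l] Δ := by
    have := hT.trans_isLittleO (isLittleO_pow_of_lt hΔ (show 1 < k + 1 by omega))
    simpa using this
  have hb0 : (fun t => 1 - b t 0) =O[l] x := by
    have h1 : (fun t => b t 0 - ∑ n ∈ Finset.range (k + 1), a n 0 * x t ^ n) =O[l] x := by
      have h2 := (hb 0 (Nat.zero_le k)).isBigO.trans (isBigO_pow_of_le hx (m := 1) (by omega))
      simpa using h2
    have h2 : (fun t => ∑ n ∈ Finset.range k, a (n + 1) 0 * x t ^ (n + 1)) =O[l] x := by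
      refine IsBigO.fun_sum fun n _ => ?_
      have := (isBigO_pow_of_le hx (show 1 ≤ n + 1 by omega)).const_mul_left (a (n + 1) 0)
      simpa using this
    refine (h1.add h2).neg_left.congr_left fun t => ?_
    rw [Finset.sum_range_succ', h00]
    ring
  have h1 : Δ =O[l] fun t => Δ t * H t := isBigO_mul_of_tendsto_ne_zero hHt h01
  have h2 := (hEo.trans_isBigO h1).right_isBigO_add
  refine h1.trans (h2.trans (hb0.congr_left fun t => ?_))
  simp only [hE, hH]
  rw [Finset.sum_range_succ', Finset.mul_sum]
  have : ∀ r ∈ Finset.range k, Δ t * (Δ t ^ r / ((r + 1).factorial : ℝ) * b t (r + 1))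
      = Δ t ^ (r + 1) / ((r + 1).factorial : ℝ) * b t (r + 1) := fun r _ => by ring
  rw [Finset.sum_congr rfl this]
  simp
  ring

theorem coeffPoly_eval (k : ℕ) (c : ℕ → ℝ) (y : ℝ) :
    (coeffPoly k c).eval y = ∑ n ∈ Finset.Icc 1 k, c n * y ^ n := by
  simp [coeffPoly, Polynomial.eval_finsetSum]

theorem charPoly_eval (k : ℕ) (a : ℕ → ℕ → ℝ) (c : ℕ → ℝ) (y : ℝ) :
    (charPoly k a c).eval y = ∑ m ∈ Finset.range (k + 1),
      (∑ n ∈ Finset.Icc 1 k, c n * y ^ n) ^ m / m.factorial *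
        ∑ s ∈ Finset.range (k - m + 1), a s m * y ^ s := by
  simp only [charPoly, Polynomial.eval_finsetSum, Polynomial.eval_mul, Polynomial.eval_C,
    Polynomial.eval_pow, Polynomial.eval_X, coeffPoly_eval]
  refine Finset.sum_congr rfl fun m _ => ?_
  ring

/-- Asymptotic expansion of the increment of the root of a perturbed equation. -/
theorem isLittleO_root_expansion {b : α → ℕ → ℝ} {a : ℕ → ℕ → ℝ} {c : ℕ → ℝ} {k : ℕ}
    (hx : Tendsto x l (𝓝 0)) (hΔ : Tendsto Δ l (𝓝 0))
    (hb : ∀ r ≤ k, (fun t => b t r - ∑ n ∈ Finset.range (k - r + 1), a n r * x t ^ n)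
      =o[l] fun t => x t ^ (k - r))
    (hT : (fun t => 1 - ∑ r ∈ Finset.range (k + 1), Δ t ^ r / r.factorial * b t r)
      =O[l] fun t => Δ t ^ (k + 1))
    (h00 : a 0 0 = 1) (h01 : 1 ≤ k → a 0 1 ≠ 0) (hc : CoeffRecursion k a c) :
    (fun t => Δ t - ∑ n ∈ Finset.Icc 1 k, c n * x t ^ n) =o[l] fun t => x t ^ k := by
  rcases Nat.eq_zero_or_pos k with rfl | hk
  · simpa using hΔ
  have h01 := h01 hk
  have hΔx := isBigO_of_root hk hx hΔ hb hT h00 h01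
  set A : α → ℕ → ℝ := fun t r => ∑ n ∈ Finset.range (k - r + 1), a n r * x t ^ n with hA
  set p : α → ℝ := fun t => ∑ n ∈ Finset.Icc 1 k, c n * x t ^ n with hp
  have hpt : Tendsto p l (𝓝 0) := by
    have : Tendsto p l (𝓝 (∑ n ∈ Finset.Icc 1 k, c n * 0 ^ n)) :=
      tendsto_finsetSum _ fun n _ => (hx.pow n).const_mul _
    rwa [Finset.sum_eq_zero fun n hn => by
      rw [Finset.mem_Icc] at hn; rw [zero_pow (by omega), mul_zero]] at this
  -- Because Δ = O(x), an error o(x^{k−r}) in the r-th coefficient is multiplied by O(x^r), so each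
  -- replacement costs only o(x^k).
  have h1 : (fun t => 1 - ∑ r ∈ Finset.range (k + 1), Δ t ^ r / r.factorial * A t r)
      =o[l] fun t => x t ^ k := by
    have e1 : (fun t => ∑ r ∈ Finset.range (k + 1), Δ t ^ r / r.factorial * (b t r - A t r))
        =o[l] fun t => x t ^ k := by
      refine IsLittleO.fun_sum fun r hr => ?_
      have hr := Finset.mem_range.1 hr
      have e2 : (fun t => Δ t ^ r / r.factorial) =O[l] fun t => x t ^ r := by
        simp only [div_eq_inv_mul]
        exact (hΔx.pow r).const_mul_left _
      refine (e2.mul_isLittleO (hb r (by omega))).congr_right fun t => ?_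
      rw [← pow_add, Nat.add_sub_cancel' (by omega)]
    have e3 : (fun t => 1 - ∑ r ∈ Finset.range (k + 1), Δ t ^ r / r.factorial * b t r)
        =o[l] fun t => x t ^ k :=
      (hT.trans (hΔx.pow (k + 1))).trans_isLittleO (isLittleO_pow_of_lt hx k.lt_succ_self)
    refine (e1.add e3).congr_left fun t => ?_
    simp only [mul_sub, Finset.sum_sub_distrib]
    ring
  have h2 : (fun t => ∑ r ∈ Finset.range (k + 1), p t ^ r / r.factorial * A t r - 1)
      =o[l] fun t => x t ^ k := by
    obtain ⟨Q, hQ⟩ := X_pow_dvd_charPoly_sub_one h00 (fun _ => h01) hc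
    have e1 : (fun t => x t ^ (k + 1) * Q.eval (x t)) =O[l] fun t => x t ^ (k + 1) * 1 :=
      (isBigO_refl _ _).mul (((Q.continuous.tendsto 0).comp hx).isBigO_one ℝ)
    simp only [mul_one] at e1
    refine (e1.trans_isLittleO (isLittleO_pow_of_lt hx k.lt_succ_self)).congr_left fun t => ?_
    have := congrArg (Polynomial.eval (x t)) hQ
    rw [Polynomial.eval_sub, charPoly_eval, Polynomial.eval_mul, Polynomial.eval_pow,
      Polynomial.eval_X, Polynomial.eval_one] at this
    exact this.symm
  -- H is the divided difference of the truncated polynomial between Δ and p, obtained by factoring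
  -- Δ − p out of each difference of powers.
  set H : α → ℝ := fun t => ∑ r ∈ Finset.range k, A t (r + 1) / (r + 1).factorial *
    ∑ i ∈ Finset.range (r + 1), Δ t ^ i * p t ^ (r - i) with hH
  have hHt : Tendsto H l (𝓝 (a 0 1)) := by
    have e1 : Tendsto H l (𝓝 (∑ r ∈ Finset.range k, a 0 (r + 1) / (r + 1).factorial *
        ∑ i ∈ Finset.range (r + 1), (0 : ℝ) ^ i * 0 ^ (r - i))) :=
      tendsto_finsetSum _ fun r _ =>
        ((tendsto_sum_mul_pow hx (fun n => a n (r + 1)) _).div_const _).mul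
          (tendsto_finsetSum _ fun i _ => (hΔ.pow i).mul (hpt.pow (r - i)))
    rwa [Finset.sum_eq_single_of_mem 0 (Finset.mem_range.2 hk) (fun r _ hr => by
      rw [Finset.sum_eq_zero fun i hi => ?_, mul_zero]
      have := Finset.mem_range.1 hi
      rw [← pow_add, zero_pow (by omega)]), zero_add, Finset.sum_range_one, Nat.factorial_one,
      Nat.cast_one, div_one, pow_zero, mul_one, mul_one] at e1
  have h3 : (fun t => (Δ t - p t) * H t) =o[l] fun t => x t ^ k := by
    refine (h1.add h2).neg_left.congr_left fun t => ?_
    have e1 : ∀ r ∈ Finset.range k, (Δ t - p t) * (A t (r + 1) / (r + 1).factorial *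
        ∑ i ∈ Finset.range (r + 1), Δ t ^ i * p t ^ (r - i))
        = Δ t ^ (r + 1) / (r + 1).factorial * A t (r + 1)
          - p t ^ (r + 1) / (r + 1).factorial * A t (r + 1) := fun r _ => by
      have := geom_sum₂_mul (Δ t) (p t) (r + 1)
      simp only [Nat.add_sub_cancel] at this
      linear_combination (A t (r + 1) / (r + 1).factorial) * this
    simp only [hH]
    rw [Finset.mul_sum, Finset.sum_congr rfl e1, Finset.sum_sub_distrib, Finset.sum_range_succ',
      Finset.sum_range_succ' (fun r => p t ^ r / r.factorial * A t r)]
    simp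
  exact (isBigO_mul_of_tendsto_ne_zero hHt h01).trans_isLittleO h3

end

end PerturbedRegenerative

/-! ### From stopped processes to real sequences -/

namespace StoppedRegenerativeProcess

open PerturbedRegenerative

section

variable {𝒳 : Type*} [MeasurableSpace 𝒳] (S : StoppedRegenerativeProcess 𝒳)

theorem f_nonneg (n : ℕ) : 0 ≤ S.f n := measureReal_nonneg

theorem q_nonneg (n : ℕ) (A : Set 𝒳) : 0 ≤ S.q n A := measureReal_nonneg

theorem prob_nonneg (n : ℕ) (A : Set 𝒳) : 0 ≤ S.prob n A := measureReal_nonneg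

theorem q_le_univ (n : ℕ) (A : Set 𝒳) : S.q n A ≤ S.q n Set.univ :=
  measureReal_mono fun _ h => ⟨Set.mem_univ _, h.2⟩

theorem f_zero : S.f 0 = 0 := by
  rw [f, measureReal_eq_zero_iff, measure_eq_zero_iff_ae_notMem]
  filter_upwards [S.τ_zero, S.τ_strictMono] with ω h0 h1 h
  have h2 : S.τ 0 ω < S.τ 1 ω := h1 Nat.zero_lt_one
  have h3 : S.τ 1 ω = 0 := h.1
  omega

theorem tsum_f_le_one : ∑' n, S.f n ≤ 1 := by
  refine Real.tsum_le_of_sum_range_le S.f_nonneg fun n => ?_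
  have h1 : ∀ k, S.f k ≤ S.P.real (S.τ 1 ⁻¹' {k}) := fun k =>
    measureReal_mono fun _ h => h.1
  refine (Finset.sum_le_sum fun k _ => h1 k).trans ?_
  rw [← measureReal_biUnion_finset]
  · exact measureReal_le_one
  · intro i _ j _ hij
    exact Disjoint.preimage _ (Set.disjoint_singleton.2 hij)
  · exact fun k _ => S.measurable_τ 1 (measurableSet_singleton k)

theorem phi_toReal (ρ : ℝ) (r : ℕ) : (S.phi ρ r).toReal = expMoment S.f ρ r := by
  rw [phi, ENNReal.tsum_toReal_eq fun _ => ENNReal.ofReal_ne_top, expMoment]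
  exact tsum_congr fun n => ENNReal.toReal_ofReal (expMoment_term_nonneg S.f_nonneg ρ r n)

theorem qSum_toReal (ρ : ℝ) (A : Set 𝒳) :
    (S.qSum ρ A).toReal = ∑' n : ℕ, Real.exp (ρ * n) * S.q n A := by
  rw [qSum, ENNReal.tsum_toReal_eq fun _ => ENNReal.ofReal_ne_top]
  exact tsum_congr fun n =>
    ENNReal.toReal_ofReal (mul_nonneg (Real.exp_pos _).le (S.q_nonneg n A))

/-- No finiteness assumption is required, since `toReal` sends ∞ to 0 and not to 1. -/
theorem phi_eq_one_iff (ρ : ℝ) (r : ℕ) : S.phi ρ r = 1 ↔ expMoment S.f ρ r = 1 := by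
  rw [← phi_toReal]
  constructor
  · intro h; rw [h, ENNReal.toReal_one]
  · intro h
    have h1 : S.phi ρ r ≠ ∞ := fun h2 => by simp [h2] at h
    rw [← ENNReal.ofReal_toReal h1, h, ENNReal.ofReal_one]

theorem summable_of_phi_ne_top {ρ : ℝ} {r : ℕ} (h : S.phi ρ r ≠ ∞) :
    Summable fun n : ℕ => (n : ℝ) ^ r * Real.exp (ρ * n) * S.f n :=
  (ENNReal.summable_toReal h).congr fun n =>
    ENNReal.toReal_ofReal (expMoment_term_nonneg S.f_nonneg ρ r n)

theorem exp_mul_f_le {δ : ℝ} {M : ℝ≥0∞} (hM : M ≠ ∞) (h : S.phi δ 0 ≤ M) (n : ℕ) :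
    Real.exp (δ * n) * S.f n ≤ M.toReal := by
  have h1 := (ENNReal.le_tsum n).trans h
  have h2 := (ENNReal.ofReal_le_iff_le_toReal hM).1 h1
  simpa using h2

theorem exp_mul_q_le {δ : ℝ} {M : ℝ≥0∞} (hM : M ≠ ∞) (h : S.qSum δ Set.univ ≤ M) (n : ℕ)
    (A : Set 𝒳) : Real.exp (δ * n) * S.q n A ≤ M.toReal := by
  have h1 := (ENNReal.le_tsum n).trans h
  exact (mul_le_mul_of_nonneg_left (S.q_le_univ n A) (Real.exp_pos _).le).trans
    ((ENNReal.ofReal_le_iff_le_toReal hM).1 h1)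

theorem charRoot_spec (hpos : ∃ n, n ≠ 0 ∧ 0 < S.f n) {ρ : ℝ} (h : S.IsCharRoot ρ) :
    S.charRoot = ρ ∧ ∀ ρ', S.IsCharRoot ρ' → ρ' = ρ := by
  have huniq : ∀ ρ', S.IsCharRoot ρ' → ρ' = ρ := fun ρ' h' =>
    expMoment_root_unique S.f_nonneg hpos ((S.phi_eq_one_iff ρ' 0).1 h'.2)
      ((S.phi_eq_one_iff ρ 0).1 h.2)
  refine ⟨?_, huniq⟩
  have : {ρ : ℝ | S.IsCharRoot ρ} = {ρ} := by
    ext ρ'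
    exact ⟨huniq ρ', fun h' => by rw [Set.mem_singleton_iff.1 h']; exact h⟩
  rw [charRoot, this, csInf_singleton]

theorem expMoment_zero_le_one : expMoment S.f 0 0 ≤ 1 := by
  simpa [expMoment] using S.tsum_f_le_one

/-- Exponential tilting of the renewal equation. -/
theorem IsRegenerativeStoppingTime.exp_mul_prob {S : StoppedRegenerativeProcess 𝒳}
    (hS : S.IsRegenerativeStoppingTime) {A : Set 𝒳} (hA : MeasurableSet A) (ρ : ℝ) (n : ℕ) :
    Real.exp (ρ * n) * S.prob n A = Real.exp (ρ * n) * S.q n A +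
      ∑ j ∈ Finset.range (n + 1), Real.exp (ρ * (n - j : ℕ)) * S.prob (n - j) A *
        (Real.exp (ρ * j) * S.f j) := by
  rw [hS A hA n, mul_add, Finset.mul_sum]
  congr 1
  refine Finset.sum_congr rfl fun j hj => ?_
  have hj := Finset.mem_range.1 hj
  have : Real.exp (ρ * n) = Real.exp (ρ * (n - j : ℕ)) * Real.exp (ρ * j) := by
    rw [← Real.exp_add, ← mul_add, ← Nat.cast_add, Nat.sub_add_cancel (by omega)]
  rw [this]; ring

end

end StoppedRegenerativeProcess

/-! ### Assembly under the conditions of the theorem -/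

namespace PerturbedRegenerative

theorem nhdsGT_zero_eq_compl : 𝓝[>] (0 : ℝ≥0) = 𝓝[{0}ᶜ] 0 := by
  congr 1
  ext y
  rw [Set.mem_Ioi, Set.mem_compl_singleton_iff, pos_iff_ne_zero]

/-- In `ℝ≥0` the right neighbourhoods of 0 are the punctured ones, so adding the point 0 with its
own value costs nothing. -/
theorem tendsto_nhds_of_nhdsGT {F : ℝ≥0 → ℝ} (h : Tendsto F (𝓝[>] 0) (𝓝 (F 0))) :
    Tendsto F (𝓝 0) (𝓝 (F 0)) := by
  rw [nhdsGT_zero_eq_compl] at h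
  exact continuousWithinAt_compl_self.1 h

theorem exists_bound_of_limsup_lt_top {α : Type*} {l : Filter α} {u : α → ℝ≥0∞}
    (h : limsup u l < ∞) : ∃ M : ℝ≥0∞, M ≠ ∞ ∧ ∀ᶠ t in l, u t ≤ M := by
  obtain ⟨M, h1, h2⟩ := exists_between h
  exact ⟨M, h2.ne, (eventually_lt_of_limsup_lt h1).mono fun _ h => h.le⟩

/-- After the terms of order below r are removed, only c_r x^r survives multiplication by N: the
remainder is o(x^r), while x^r N stays bounded. -/
theorem tendsto_mul_of_expansion {α : Type*} {l : Filter α} {x Δ N : α → ℝ} {c : ℕ → ℝ} {k r : ℕ}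
    (hx : Tendsto x l (𝓝 0))
    (hΔ : (fun t => Δ t - ∑ n ∈ Finset.Icc 1 k, c n * x t ^ n) =o[l] fun t => x t ^ k)
    (hr : 1 ≤ r) (hrk : r ≤ k) {y : ℝ} (hN : Tendsto (fun t => x t ^ r * N t) l (𝓝 y)) :
    Tendsto (fun t => (Δ t - ∑ n ∈ Finset.Icc 1 (r - 1), c n * x t ^ n) * N t) l
      (𝓝 (y * c r)) := by
  have hsplit : Finset.Icc 1 k
      = Finset.Icc 1 (r - 1) ∪ insert r (Finset.Icc (r + 1) k) := by
    ext i; simp only [Finset.mem_union, Finset.mem_insert, Finset.mem_Icc]; omega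
  have hdisj : Disjoint (Finset.Icc 1 (r - 1)) (insert r (Finset.Icc (r + 1) k)) := by
    rw [Finset.disjoint_left]
    intro i; simp only [Finset.mem_insert, Finset.mem_Icc]; omega
  have h1 : (fun t => Δ t - ∑ n ∈ Finset.Icc 1 (r - 1), c n * x t ^ n - c r * x t ^ r)
      =o[l] fun t => x t ^ r := by
    have h2 : (fun t => ∑ n ∈ Finset.Icc (r + 1) k, c n * x t ^ n) =o[l] fun t => x t ^ r := by
      refine IsLittleO.fun_sum fun n hn => ?_
      rw [Finset.mem_Icc] at hn
      exact (isLittleO_pow_of_lt hx (by omega)).const_mul_left _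
    refine ((hΔ.trans_isBigO (isBigO_pow_of_le hx hrk)).add h2).congr_left fun t => ?_
    rw [hsplit, Finset.sum_union hdisj, Finset.sum_insert (by simp)]
    ring
  have h3 : Tendsto (fun t => (Δ t - ∑ n ∈ Finset.Icc 1 (r - 1), c n * x t ^ n - c r * x t ^ r)
      * N t) l (𝓝 0) :=
    (isLittleO_one_iff ℝ).1 ((h1.mul_isBigO (isBigO_refl N l)).trans_isBigO (hN.isBigO_one ℝ))
  have h4 := h3.add (hN.mul_const (c r))
  rw [zero_add] at h4
  exact h4.congr fun t => by ring

variable {𝒳 : Type*} [MeasurableSpace 𝒳] {S : ℝ≥0 → StoppedRegenerativeProcess 𝒳}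

theorem CondA.tendsto_f_nhds (hA : CondA S) (n : ℕ) :
    Tendsto (fun ε => (S ε).f n) (𝓝 0) (𝓝 ((S 0).f n)) :=
  tendsto_nhds_of_nhdsGT (F := fun ε => (S ε).f n) (hA.tendsto_f n)

/-- Uniform domination, existence and uniqueness of the root, and its convergence. -/
theorem exists_charRoot (hA : CondA S) (hB : CondB S) :
    ∃ δ M : ℝ, (S 0).charRoot < δ ∧
      (∀ᶠ ε in 𝓝 (0 : ℝ≥0), (∀ n, 0 ≤ (S ε).f n) ∧
        ∀ n : ℕ, Real.exp (δ * n) * (S ε).f n ≤ M) ∧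
      (∀ᶠ ε in 𝓝 (0 : ℝ≥0), (S ε).IsCharRoot (S ε).charRoot ∧
        ∀ ρ, (S ε).IsCharRoot ρ → ρ = (S ε).charRoot) ∧
      Tendsto (fun ε => (S ε).charRoot) (𝓝 0) (𝓝 (S 0).charRoot) := by
  obtain ⟨δ, hδ, hlim, hgt⟩ := hB
  obtain ⟨M, hM, hle⟩ := exists_bound_of_limsup_lt_top hlim
  have hbound : ∀ᶠ ε in 𝓝 (0 : ℝ≥0), (∀ n, 0 ≤ (S ε).f n) ∧
      ∀ n : ℕ, Real.exp (δ * n) * (S ε).f n ≤ M.toReal :=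
    hle.mono fun ε h => ⟨(S ε).f_nonneg, (S ε).exp_mul_f_le hM h⟩
  have hft := hA.tendsto_f_nhds
  have hpos₀ := hA.not_concentrated_zero
  have hf₀ := (S 0).f_nonneg
  have hf₀M := hbound.self_of_nhds.2
  have hphi₀ : (S 0).phi δ 0 ≠ ∞ := (hle.self_of_nhds.trans_lt hM.lt_top).ne
  have hgt' : 1 < expMoment (S 0).f δ 0 := by
    rw [← StoppedRegenerativeProcess.phi_toReal, ← ENNReal.toReal_one]
    exact (ENNReal.toReal_lt_toReal ENNReal.one_ne_top hphi₀).2 hgt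
  obtain ⟨ρ, h0, hlt, hroot⟩ := exists_expMoment_root hf₀ hδ.le
    ((S 0).summable_of_phi_ne_top hphi₀) (S 0).expMoment_zero_le_one hgt'
  have hchar := ((S 0).charRoot_spec hpos₀ ⟨h0, ((S 0).phi_eq_one_iff ρ 0).2 hroot⟩).1
  -- The upper bracket is moved strictly below δ, where the moments converge, so that it serves for
  -- all small ε.
  obtain ⟨β, hβ1, hβ2⟩ := exists_between hlt
  have hβ : 1 < expMoment (S 0).f β 0 :=
    hroot ▸ expMoment_strictMono hf₀ hpos₀ hβ1 (summable_expMoment hf₀ hf₀M hβ2 0)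
  obtain ⟨m, hm, hfm⟩ := hpos₀
  have hex : ∀ᶠ ε in 𝓝 (0 : ℝ≥0), (S ε).IsCharRoot (S ε).charRoot ∧
        ∀ ρ, (S ε).IsCharRoot ρ → ρ = (S ε).charRoot := by
    filter_upwards [hbound, (hft m).eventually_const_lt hfm,
      (tendsto_expMoment hbound hft hβ2 tendsto_const_nhds 0).eventually_const_lt hβ]
      with ε ⟨h1, h2⟩ h3 h4
    obtain ⟨ρ', h5, _, h6⟩ := exists_expMoment_root h1 (h0.trans hβ1.le)
      (summable_expMoment h1 h2 hβ2 0) (S ε).expMoment_zero_le_one h4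
    have h7 : (S ε).IsCharRoot ρ' := ⟨h5, ((S ε).phi_eq_one_iff ρ' 0).2 h6⟩
    obtain ⟨h8, h9⟩ := (S ε).charRoot_spec ⟨m, hm, h3⟩ h7
    rw [h8]
    exact ⟨h7, h9⟩
  refine ⟨δ, M.toReal, by rwa [hchar], hbound, hex, ?_⟩
  refine tendsto_expMoment_root hbound hf₀ hf₀M ⟨m, hm, hfm⟩ hft (by rwa [hchar])
    (by rwa [hchar]) (hex.mono fun ε h => ((S ε).phi_eq_one_iff _ 0).1 h.1.2)

/-- The renewal limit of the tilted probabilities `e^{ρ n} P(n, A)` under perturbation. -/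
theorem tendsto_exp_mul_prob (hS : ∀ ε, (S ε).IsRegenerativeStoppingTime) (hA : CondA S)
    (hB : CondB S) (hD : CondD S) {N : ℝ≥0 → ℕ} (hN : Tendsto N (𝓝[>] 0) atTop) {A : Set 𝒳}
    (hAΓ : A ∈ Gamma0 S) :
    Tendsto (fun ε => Real.exp ((S ε).charRoot * N ε) * (S ε).prob (N ε) A) (𝓝[>] 0)
      (𝓝 ((S 0).piTilde A)) := by
  obtain ⟨δ, M, hδ, hbound, hroot, hρ⟩ := exists_charRoot hA hB
  obtain ⟨γ, hγ, hlim⟩ := hD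
  obtain ⟨K, hK, hle⟩ := exists_bound_of_limsup_lt_top hlim
  set ρ₀ := (S 0).charRoot with hρ₀
  obtain ⟨β, hβ1, hβ2⟩ := exists_between hδ
  have hroot₀ := hroot.self_of_nhds.1
  have hbound₀ := hbound.self_of_nhds
  set r := Real.exp (-(δ - β)) with hr
  have hgeo : ∀ {h : ℕ → ℝ} {ρ : ℝ}, (∀ n, 0 ≤ h n) → (∀ n : ℕ, Real.exp (δ * n) * h n ≤ M) →
      ρ ≤ β → ∀ n : ℕ, Real.exp (ρ * n) * h n ≤ M * r ^ n := by
    intro h ρ h1 h2 h3 n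
    have := expMoment_term_le h1 h2 h3 0 n
    rw [pow_zero, one_mul, one_mul] at this
    rwa [hr, ← Real.exp_nat_mul, mul_comm (n : ℝ)]
  -- Each distribution is tilted by its own root, so its total mass is exactly 1 for every small ε,
  -- not only in the limit.
  have hprop : ∀ ε, (S ε).IsCharRoot (S ε).charRoot →
      HasSum (fun n : ℕ => Real.exp ((S ε).charRoot * n) * (S ε).f n) 1 := by
    intro ε h
    have h1 := ((S ε).phi_eq_one_iff _ 0).1 h.2
    have h2 := (summable_of_expMoment_eq_one h1).hasSum
    rw [← expMoment, h1] at h2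
    simpa using h2
  have hρ' := hρ.mono_left (nhdsWithin_le_nhds (s := Set.Ioi 0))
  have key := tendsto_perturbed_renewal (l := 𝓝[>] (0 : ℝ≥0)) (M := M) (r := r)
    -- Eventually the root is below ρ₀ + γ/2, so half of the margin in D* absorbs its variation and
    -- the other half gives decay e^{-γn/2}.
    (G := fun n : ℕ => K.toReal *
      ((n : ℝ) ^ 0 * Real.exp (-((ρ₀ + γ) - (ρ₀ + γ / 2)) * n)))
    (f := fun ε n => Real.exp ((S ε).charRoot * n) * (S ε).f n)
    (g := fun ε n => Real.exp ((S ε).charRoot * n) * (S ε).q n A)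
    (x := fun ε n => Real.exp ((S ε).charRoot * n) * (S ε).prob n A)
    (f₀ := fun n => Real.exp (ρ₀ * n) * (S 0).f n)
    (g₀ := fun n => Real.exp (ρ₀ * n) * (S 0).q n A)
    (Real.exp_pos _).le (Real.exp_zero ▸ Real.exp_lt_exp.2 (by linarith))
    (summable_expMoment_bound _ (by linarith) 0)
    (by
      refine Eventually.filter_mono nhdsWithin_le_nhds ?_
      filter_upwards [hbound, hroot, hρ.eventually_lt_const hβ1] with ε ⟨h1, h2⟩ h3 h4
      exact ⟨fun n => mul_nonneg (Real.exp_pos _).le (h1 n),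
        by rw [StoppedRegenerativeProcess.f_zero, mul_zero], hprop ε h3.1, hgeo h1 h2 h4.le⟩)
    (by
      refine Eventually.filter_mono nhdsWithin_le_nhds ?_
      filter_upwards [hle, hρ.eventually_lt_const (show ρ₀ < ρ₀ + γ / 2 by linarith)]
        with ε h1 h2 n
      refine ⟨mul_nonneg (Real.exp_pos _).le ((S ε).q_nonneg n A), ?_⟩
      have := expMoment_term_le (g := fun n => (S ε).q n A) (fun n => (S ε).q_nonneg n A)
        (fun n => (S ε).exp_mul_q_le hK h1 n A) h2.le 0 n
      rwa [pow_zero, one_mul, ← pow_zero (n : ℝ)] at this)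
    (Eventually.of_forall fun ε => ⟨fun n => mul_nonneg (Real.exp_pos _).le
      ((S ε).prob_nonneg n A), fun n => (hS ε).exp_mul_prob hAΓ.1 _ n⟩)
    (fun n => mul_nonneg (Real.exp_pos _).le (hbound₀.1 n))
    (by rw [StoppedRegenerativeProcess.f_zero, mul_zero])
    (hprop 0 hroot₀) (hgeo hbound₀.1 hbound₀.2 hβ1.le)
    -- Tilting by a positive factor does not change the support, so non-periodicity is preserved.
    (fun d hd => hA.nonPeriodic d fun n hn => hd n (mul_pos (Real.exp_pos _) hn))
    (fun n => (hρ'.mul_const _).rexp.mul (hA.tendsto_f n))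
    (fun n => (hρ'.mul_const _).rexp.mul (hAΓ.2 n)) hN
  have hpi : (S 0).piTilde A = (∑' n : ℕ, Real.exp (ρ₀ * n) * (S 0).q n A) /
      ∑' n : ℕ, n * (Real.exp (ρ₀ * n) * (S 0).f n) := by
    rw [StoppedRegenerativeProcess.piTilde, StoppedRegenerativeProcess.qSum_toReal,
      StoppedRegenerativeProcess.phi_toReal, expMoment]
    simp only [pow_one, mul_assoc, hρ₀]
  rwa [hpi]

/-- Asymptotic expansion of the characteristic root. -/
theorem charRoot_expansion {k : ℕ} {a : ℕ → ℕ → ℝ} {c : ℕ → ℝ} (hA : CondA S) (hB : CondB S)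
    (hC : CondC S k a) (hc : CoeffRecursion k a c) :
    (fun ε : ℝ≥0 => (S ε).charRoot - (S 0).charRoot - ∑ n ∈ Finset.Icc 1 k, c n * (ε : ℝ) ^ n)
        =o[𝓝[>] 0] fun ε : ℝ≥0 => (ε : ℝ) ^ k := by
  obtain ⟨δ, M, hδ, hbound, hroot, hρ⟩ := exists_charRoot hA hB
  have hx : Tendsto (fun ε : ℝ≥0 => (ε : ℝ)) (𝓝[>] 0) (𝓝 0) :=
    (NNReal.continuous_coe.tendsto 0).mono_left nhdsWithin_le_nhds
  have hρ' := hρ.mono_left (nhdsWithin_le_nhds (s := Set.Ioi 0))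
  have hroot' : ∀ᶠ ε in 𝓝 (0 : ℝ≥0), expMoment (S ε).f (S ε).charRoot 0 = 1 :=
    hroot.mono fun ε h => ((S ε).phi_eq_one_iff _ 0).1 h.1.2
  have hroot₀ := hroot'.self_of_nhds
  refine isLittleO_root_expansion hx (by simpa using hρ'.sub_const (S 0).charRoot)
    (b := fun ε r => expMoment (S ε).f (S 0).charRoot r) (fun r hr => ?_)
    (one_sub_taylor_isBigO (hbound.filter_mono nhdsWithin_le_nhds) hA.tendsto_f hδ
      (hroot'.filter_mono nhdsWithin_le_nhds) hρ' k) ?_ (fun hk => ?_) hc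
  · have := hC.expansion r hr
    simpa only [StoppedRegenerativeProcess.phi_toReal] using this
  · rw [hC.a_zero 0 (Nat.zero_le k), StoppedRegenerativeProcess.phi_toReal, hroot₀]
  · rw [hC.a_zero 1 hk, StoppedRegenerativeProcess.phi_toReal]
    obtain ⟨m, hm, hfm⟩ := hA.not_concentrated_zero
    have hm' : (0 : ℝ) < m := by positivity
    refine ((summable_expMoment hbound.self_of_nhds.1 hbound.self_of_nhds.2 hδ 1).tsum_pos
      (expMoment_term_nonneg (S 0).f_nonneg _ 1) m ?_).ne'
    positivity

end PerturbedRegenerative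

theorem mainTheorem2 {𝒳 : Type u} [MeasurableSpace 𝒳]
    (S : ℝ≥0 → StoppedRegenerativeProcess.{u, v} 𝒳)
    (hS : ∀ ε, (S ε).IsRegenerativeStoppingTime)
    (k : ℕ) (a : ℕ → ℕ → ℝ)
    (hA : PerturbedRegenerative.CondA S)
    (hB : PerturbedRegenerative.CondB S)
    (hC : PerturbedRegenerative.CondC S k a) :
    -- for small `ε`, the characteristic equation has a unique non-negative root
    (∀ᶠ ε in 𝓝 (0 : ℝ≥0), (S ε).IsCharRoot (S ε).charRoot ∧
      ∀ ρ, (S ε).IsCharRoot ρ → ρ = (S ε).charRoot) ∧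
    ∃ c : ℕ → ℝ, PerturbedRegenerative.CoeffRecursion k a c ∧
      -- part (i)
      ((fun ε : ℝ≥0 => (S ε).charRoot -
          ((S 0).charRoot + ∑ n ∈ Finset.Icc 1 k, c n * (ε : ℝ) ^ n))
        =o[𝓝[>] 0] fun ε : ℝ≥0 => (ε : ℝ) ^ k) ∧
      -- part (ii)
      (PerturbedRegenerative.CondD S →
        ∀ (N : ℝ≥0 → ℕ) (r : ℕ) (l : ℝ), Tendsto N (𝓝[>] 0) atTop →
          1 ≤ r → r ≤ k → 0 ≤ l →
          Tendsto (fun ε : ℝ≥0 => (ε : ℝ) ^ r * (N ε : ℝ)) (𝓝[>] 0) (𝓝 l) →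
          ∀ A ∈ PerturbedRegenerative.Gamma0 S,
            Tendsto (fun ε : ℝ≥0 => (S ε).prob (N ε) A /
                Real.exp (-((S 0).charRoot +
                  ∑ n ∈ Finset.Icc 1 (r - 1), c n * (ε : ℝ) ^ n) * (N ε : ℝ)))
              (𝓝[>] 0) (𝓝 ((S 0).piTilde A / Real.exp (l * c r)))) := by
  obtain ⟨δ, M, hδ, hbound, hroot, hρ⟩ := PerturbedRegenerative.exists_charRoot hA hB
  obtain ⟨c, hc⟩ := PerturbedRegenerative.exists_coeffRecursion k a
  have hexp := PerturbedRegenerative.charRoot_expansion hA hB hC hc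
  refine ⟨hroot, c, hc, hexp.congr_left fun ε => by ring, ?_⟩
  intro hD N r y hN hr hrk _ hNy A hAΓ
  have hx : Tendsto (fun ε : ℝ≥0 => (ε : ℝ)) (𝓝[>] 0) (𝓝 0) :=
    (NNReal.continuous_coe.tendsto 0).mono_left nhdsWithin_le_nhds
  have h1 := PerturbedRegenerative.tendsto_exp_mul_prob hS hA hB hD hN hAΓ
  have h2 := (PerturbedRegenerative.tendsto_mul_of_expansion hx hexp hr hrk hNy).rexp
  refine (h1.div h2 (Real.exp_pos _).ne').congr fun ε => ?_
  -- The normalised probability is the tilted one divided by the exponential of (ρ⁽ᵋ⁾ minus its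
  -- expansion below order r) times N, whose limit is e^{λ_r c_r}.
  have e : Real.exp ((S ε).charRoot * N ε) = Real.exp (((S ε).charRoot - (S 0).charRoot -
      ∑ n ∈ Finset.Icc 1 (r - 1), c n * (ε : ℝ) ^ n) * N ε) / Real.exp (-((S 0).charRoot +
      ∑ n ∈ Finset.Icc 1 (r - 1), c n * (ε : ℝ) ^ n) * N ε) := by
    rw [← Real.exp_sub]
    congr 1
    ring
  rw [Pi.div_apply, e]
  field_simp
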